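/- Let $\lambda>0$ be known, and let $F$ be a probability distribution on $\mathbb{R}$ with density $f$ and characteristic function $\phi_f(t)=\int e^{ity}f(y)\,dy$. Let $X_1,X_2,\dots$ be i.i.d. random variables of the form $X_i=Y_i+Z_i$, where $Y_i$ and $Z_i$ are independent, $Z_i$ is standard normal, and $Y_i$ is distributed as $\sum_{j=1}^{N}W_j$ with $N$ Poisson distributed with parameter $\lambda$ and independent of the i.i.d. variables $W_1,W_2,\dots$ with distribution $F$ (an empty sum is $0$). Let $h=h_n>0$ be bandwidths with $h_n\sim(\log n)^{-\beta}$ (that is, the ratio tends to $1$) for some $\beta<1/2$, let $M_n=C\log n$ for a constant $C>0$, and let $\phi_{emp}(t)=\frac1n\sum_{j=1}^n e^{itX_j}$ be the empirical characteristic function. Let $\phi_w=1_{[-1,1]}$, the Fourier transform of the sinc kernel $w(x)=\sin x/(\pi x)$. Put $$f_{nh}(x)=\frac{1}{2\pi\lambda}\int_{-1/h}^{1/h}e^{-itx}\operatorname{Log}\left(\frac{\phi_{emp}(t)\phi_w(ht)}{e^{-\lambda}e^{-t^2/2}}\right)dt ,\qquad \hat f_{nh}(x)=(M_n\wedge f_{nh}(x))\vee(-M_n),$$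 where $\operatorname{Log}$ is the distinguished logarithm, i.e. the continuous function $L$ on $[-1/h,1/h]$ such that $e^{L}$ equals the argument and $L(0)=\lambda$; if no such function exists, $f_{nh}(x)$ is set to $0$. Assume that $\phi_f$ is integrable and that $\int|y|^{\rho}f(y)\,dy<\infty$ for some $\rho>1$. Let $x\in\mathbb{R}$ be a point at which $f$ is continuous (as $\phi_f$ is integrable, $f$ has a continuous version, for which every $x$ is admissible). Then $\hat f_{nh}(x)$ is integrable for every $n$, and the following hold. (i) If $\phi_f(t)=O(e^{-|t|^{\alpha}})$ as $|t|\to\infty$ for some $1<\alpha\le 2$, then $$\operatorname{E}[\hat f_{nh}(x)]-f(x)=O\left(h^{\alpha-1}e^{-1/h^{\alpha}}\right)\quad\text{as } n\to\infty .$$ (ii) If $\phi_f(t)=O(|t|^{-\gamma})$ as $|t|\to\infty$ for some $\gamma>1$, then $$\operatorname{E}[\hat f_{nh}(x)]-f(x)=O\left(h^{\gamma-1}\right)\quad\text{as } n\to\infty .$$ -/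

import Mathlib

open MeasureTheory ProbabilityTheory Filter Asymptotics
open scoped NNReal

namespace Decompounding

noncomputable section

/-- The law of a Poisson sum `∑_{j=1}^{N} W_j`, where `N` is Poisson with parameter `lam`, the `W_j`
are i.i.d. with law `F`, and `N` is independent of `(W_j)`. -/
def compoundPoisson (lam : ℝ≥0) (F : Measure ℝ) [IsProbabilityMeasure F] : Measure ℝ :=
  ((poissonMeasure lam).prod (Measure.infinitePi fun _ : ℕ => F)).map
    fun p => ∑ j ∈ Finset.range p.1, p.2 j

/-- The map whose law is `compoundPoisson` is measurable, so that `Measure.map` is meaningful. -/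
theorem measurable_randomSum :
    Measurable fun p : ℕ × (ℕ → ℝ) => ∑ j ∈ Finset.range p.1, p.2 j :=
  measurable_from_prod_countable_right fun k => by
    change Measurable fun w : ℕ → ℝ => ∑ j ∈ Finset.range k, w j
    fun_prop

/-- The sinc kernel `w(x) = sin x / (π x)`, with `w(0) = 1 / π`. -/
def sincKernel (x : ℝ) : ℝ := Real.sinc x / Real.pi

/-- The Fourier transform `φ_w = 1_{[-1,1]}` of the sinc kernel. -/
def sincKernelFT (t : ℝ) : ℝ := (Set.Icc (-1 : ℝ) 1).indicator (fun _ => 1) t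

/-- The empirical characteristic function of a sample of size `n`. -/
def empCharFun {n : ℕ} (xs : Fin n → ℝ) (t : ℝ) : ℂ :=
  (1 / (n : ℂ)) * ∑ j, Complex.exp (Complex.I * t * xs j)

/-- `L` is a distinguished logarithm of `g` on `s`: a continuous logarithm on `s`, whose value at `0`
is the principal one (this is the real logarithm when `g 0 > 0`). -/
def IsDistinguishedLog (g L : ℝ → ℂ) (s : Set ℝ) : Prop :=
  ContinuousOn L s ∧ (∀ t ∈ s, Complex.exp (L t) = g t) ∧ L 0 = Complex.log (g 0)

open Classical in
/-- The distinguished logarithm of `g` on `s`; by convention it is `0` if there is none. -/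
def distinguishedLog (g : ℝ → ℂ) (s : Set ℝ) : ℝ → ℂ :=
  if H : ∃ L, IsDistinguishedLog g L s then H.choose else 0

/-- The distinguished logarithm is unique on an interval that contains `0`. -/
theorem IsDistinguishedLog.eqOn {g L₁ L₂ : ℝ → ℂ} {s : Set ℝ} (hs : IsPreconnected s)
    (h0 : (0 : ℝ) ∈ s) (h₁ : IsDistinguishedLog g L₁ s) (h₂ : IsDistinguishedLog g L₂ s) :
    Set.EqOn L₁ L₂ s :=
  Complex.isCoveringMap_exp.eqOn_of_comp_eqOn hs h₁.1 h₂.1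
    (fun t ht => Subtype.ext ((h₁.2.1 t ht).trans (h₂.2.1 t ht).symm)) h0
    (h₁.2.2.trans h₂.2.2.symm)

/-- `φ_emp(t) φ_w(ht) / (e^{-lam} e^{-t²/2})`, the estimator of `exp (lam φ_f(t))`. -/
def plugInRatio (lam h : ℝ) {n : ℕ} (xs : Fin n → ℝ) (t : ℝ) : ℂ :=
  empCharFun xs t * (sincKernelFT (h * t) : ℂ) /
    (Complex.exp (-(lam : ℂ)) * Complex.exp (-(t : ℂ) ^ 2 / 2))

/-- `(2π lam)⁻¹ ∫_{-1/h}^{1/h} e^{-itx} Log (φ_emp(t) φ_w(ht) / (e^{-lam} e^{-t²/2})) dt`, as a complex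
number; it is `0` if the distinguished logarithm on `[-1/h, 1/h]` does not exist. -/
def fnhComplex (lam h : ℝ) {n : ℕ} (xs : Fin n → ℝ) (x : ℝ) : ℂ :=
  1 / (2 * Real.pi * lam) * ∫ t in (-(1 / h))..(1 / h), Complex.exp (-Complex.I * t * x) *
    distinguishedLog (plugInRatio lam h xs) (Set.Icc (-(1 / h)) (1 / h)) t

/-- The plug-in estimator `f_{nh}(x)`. Taking the real part changes nothing, see `fnhComplex_im`. -/
def fnh (lam h : ℝ) {n : ℕ} (xs : Fin n → ℝ) (x : ℝ) : ℝ := (fnhComplex lam h xs x).re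

/-- The truncated estimator `(M ∧ f_{nh}(x)) ∨ (-M)`. -/
def fHat (lam h M : ℝ) {n : ℕ} (xs : Fin n → ℝ) (x : ℝ) : ℝ := max (min M (fnh lam h xs x)) (-M)

/-- `φ_w` is the Fourier transform of `w` (which is not integrable) in the sense of inversion. -/
theorem sincKernel_eq (x : ℝ) :
    (sincKernel x : ℂ) =
      1 / (2 * Real.pi) * ∫ t : ℝ, Complex.exp (-Complex.I * t * x) * (sincKernelFT t : ℂ) := by
  have h1 : (∫ t : ℝ, Complex.exp (-Complex.I * t * x) * (sincKernelFT t : ℂ)) =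
      ∫ t in (-1 : ℝ)..1, Complex.exp (-Complex.I * t * x) := by
    rw [intervalIntegral.integral_of_le (by norm_num), ← integral_Icc_eq_integral_Ioc,
      ← integral_indicator measurableSet_Icc]
    congr 1 with t
    by_cases ht : t ∈ Set.Icc (-1 : ℝ) 1
    · simp only [sincKernelFT, Set.indicator_of_mem ht]; simp
    · simp only [sincKernelFT, Set.indicator_of_notMem ht]; simp
  rw [h1]
  have hpi : (Real.pi : ℂ) ≠ 0 := by exact_mod_cast Real.pi_ne_zero
  by_cases hx : x = 0
  · subst hx
    simp [sincKernel]
    field_simp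
    norm_num
  · have h2 := integral_exp_mul_I_eq_sinc x
    have h3 : (∫ t in (-1 : ℝ)..1, Complex.exp (-Complex.I * t * x)) =
        (x : ℂ)⁻¹ * ∫ t in (-x)..x, Complex.exp (t * Complex.I) := by
      have := intervalIntegral.integral_comp_mul_left (a := -1) (b := 1)
        (fun t : ℝ => Complex.exp (t * Complex.I)) (c := -x) (by simpa using hx)
      have e : (∫ t in (-1 : ℝ)..1, Complex.exp (-Complex.I * t * x)) =
          ∫ t in (-1 : ℝ)..1, Complex.exp (((-x * t : ℝ) : ℂ) * Complex.I) := by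
        congr 1 with t
        congr 1
        push_cast
        ring
      rw [e, this, intervalIntegral.integral_symm]
      simp [Complex.real_smul]
    rw [h3, h2, sincKernel]
    have : (x : ℂ) ≠ 0 := by exact_mod_cast hx
    push_cast
    field_simp

/-- By Hermitian symmetry of the distinguished logarithm the estimator is real. -/
theorem fnhComplex_im (lam h : ℝ) (hh : 0 < h) {n : ℕ} (xs : Fin n → ℝ) (x : ℝ) :
    (fnhComplex lam h xs x).im = 0 := by
  set T := 1 / h with hT
  have hT0 : 0 < T := by positivity
  set g := plugInRatio lam h xs with hg
  set L := distinguishedLog g (Set.Icc (-T) T) with hL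
  have hgs : ∀ t, (starRingEnd ℂ) (g (-t)) = g t := by
    intro t
    have hw : sincKernelFT (h * -t) = sincKernelFT (h * t) := by
      unfold sincKernelFT Set.indicator
      have : h * -t ∈ Set.Icc (-1 : ℝ) 1 ↔ h * t ∈ Set.Icc (-1 : ℝ) 1 := by
        simp only [Set.mem_Icc]
        constructor <;> intro ⟨a, b⟩ <;> constructor <;> linarith
      simp only [this]
    simp only [hg, plugInRatio, empCharFun, hw, map_div₀, map_mul, map_sum, ← Complex.exp_conj]
    simp [map_ofNat]
  have hLs : ∀ t ∈ Set.Icc (-T) T, (starRingEnd ℂ) (L (-t)) = L t := by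
    by_cases H : ∃ L, IsDistinguishedLog g L (Set.Icc (-T) T)
    · have hspec : IsDistinguishedLog g L (Set.Icc (-T) T) := by
        rw [hL, distinguishedLog, dif_pos H]
        exact H.choose_spec
      have hneg : Set.MapsTo (fun t : ℝ => -t) (Set.Icc (-T) T) (Set.Icc (-T) T) := by
        intro t ht
        simp only [Set.mem_Icc] at ht ⊢
        constructor <;> linarith [ht.1, ht.2]
      refine IsDistinguishedLog.eqOn (L₁ := fun t => (starRingEnd ℂ) (L (-t)))
        isPreconnected_Icc (by simp [hT0.le]) ⟨?_, ?_, ?_⟩ hspec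
      · exact Complex.continuous_conj.comp_continuousOn
          (hspec.1.comp continuous_neg.continuousOn hneg)
      · intro t ht
        simp only [Complex.exp_conj]
        rw [hspec.2.1 _ (hneg ht), hgs]
      · have hr : g 0 = (Real.exp lam : ℂ) ∨ g 0 = 0 := by
          rcases Nat.eq_zero_or_pos n with rfl | hn
          · right
            simp [hg, plugInRatio, empCharFun]
          · left
            have : (n : ℂ) ≠ 0 := by exact_mod_cast hn.ne'
            simp [hg, plugInRatio, empCharFun, sincKernelFT, Complex.exp_neg, this]
        have h0 : L 0 = Complex.log (g 0) := hspec.2.2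
        simp only [neg_zero, h0]
        rcases hr with hr | hr
        · rw [hr, ← Complex.ofReal_log (Real.exp_pos _).le, Complex.conj_ofReal]
        · simp [hr]
    · intro t _
      simp [hL, distinguishedLog, dif_neg H]
  rw [← Complex.conj_eq_iff_im]
  unfold fnhComplex
  rw [map_mul]
  congr 1
  · simp [map_ofNat]
  rw [← intervalIntegral.intervalIntegral_conj]
  change ∫ t in (-T)..T, (starRingEnd ℂ) (Complex.exp (-Complex.I * t * x) * L t) =
    ∫ t in (-T)..T, Complex.exp (-Complex.I * t * x) * L t
  have hsub := intervalIntegral.integral_comp_neg (a := -T) (b := T)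
    fun t : ℝ => (starRingEnd ℂ) (Complex.exp (-Complex.I * t * x) * L t)
  rw [neg_neg] at hsub
  rw [← hsub]
  refine intervalIntegral.integral_congr fun t ht => ?_
  rw [Set.uIcc_of_le (by linarith)] at ht
  have := hLs t ht
  simp only [map_mul, ← Complex.exp_conj, this]
  simp

end

end Decompounding

/-!
Write `φ` for the characteristic function of `F` and `T = 1 / h`. The characteristic function of the
observations is `e^{-λ} e^{-t²/2} e^{λ φ(t)}`, so that `λ φ` is the distinguished logarithm of the
ratio which `plugInRatio` estimates. On `[-T, T]` the relative error of `plugInRatio` is at most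
`e^{2λ + T²/2}` times the largest deviation of the empirical characteristic function. Once
this is at most `1/2`, the distinguished logarithms differ by at most `3/2` times it, since
`log (1 + z)` can be taken on the principal branch. When it is larger, the truncation at `M` bounds
the estimator instead.

The expected largest deviation is `O((1 + T) n^{-1/4})`: the characteristic functions are Lipschitz,
so a pointwise value is controlled by an average over a window, and pointwise deviations are of
order `n^{-1/2}`. As `T = o(√(log n))`, the factor `e^{T²/2}` grows slower than any power of `n`,
hence the stochastic error is smaller than any of the claimed rates. What remains is the error of
cutting the Fourier inversion integral off at `T`, which is the tail integral of `|φ|` beyond `T`.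
-/

namespace Decompounding

section DistinguishedLog

variable {g g' L : ℝ → ℂ} {s : Set ℝ} {δ : ℝ}

theorem IsDistinguishedLog.ne_zero (hL : IsDistinguishedLog g L s) {t : ℝ} (ht : t ∈ s) :
    g t ≠ 0 := by
  rw [← hL.2.1 t ht]
  exact Complex.exp_ne_zero _

theorem IsDistinguishedLog.continuousOn (hL : IsDistinguishedLog g L s) : ContinuousOn g s :=
  (Complex.continuous_exp.comp_continuousOn hL.1).congr fun t ht => (hL.2.1 t ht).symm

theorem isDistinguishedLog_distinguishedLog (H : ∃ L, IsDistinguishedLog g L s) :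
    IsDistinguishedLog g (distinguishedLog g s) s := by
  rw [distinguishedLog, dif_pos H]
  exact H.choose_spec

theorem IsDistinguishedLog.exists_norm_sub_le (hL : IsDistinguishedLog g L s)
    (hg' : ContinuousOn g' s) (h0 : g' 0 = g 0) (hδ : δ ≤ 1 / 2)
    (hclose : ∀ t ∈ s, ‖g' t - g t‖ ≤ δ * ‖g t‖) :
    ∃ L', IsDistinguishedLog g' L' s ∧ ∀ t ∈ s, ‖L' t - L t‖ ≤ 3 / 2 * δ := by
  have hratio : ∀ t ∈ s, ‖(g' t - g t) / g t‖ ≤ δ := fun t ht => by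
    rw [norm_div, div_le_iff₀ (norm_pos_iff.2 (hL.ne_zero ht))]
    exact hclose t ht
  have hslit : ∀ t ∈ s, 1 + (g' t - g t) / g t ∈ Complex.slitPlane := fun t ht =>
    Complex.mem_slitPlane_of_norm_lt_one (by linarith [hratio t ht])
  refine ⟨fun t => L t + Complex.log (1 + (g' t - g t) / g t), ⟨?_, fun t ht => ?_, ?_⟩,
    fun t ht => ?_⟩
  · exact hL.1.add (ContinuousOn.clog (continuousOn_const.add
      ((hg'.sub hL.continuousOn).div hL.continuousOn fun t ht => hL.ne_zero ht)) hslit)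
  · have := hL.ne_zero ht
    rw [Complex.exp_add, hL.2.1 t ht, Complex.exp_log (Complex.slitPlane_ne_zero (hslit t ht))]
    field_simp
    ring
  · simp [h0, hL.2.2]
  · rw [add_sub_cancel_left]
    exact (Complex.norm_log_one_add_half_le_self ((hratio t ht).trans hδ)).trans
      (by linarith [hratio t ht])

theorem IsDistinguishedLog.norm_distinguishedLog_sub_le (hL : IsDistinguishedLog g L s)
    (hs : IsPreconnected s) (hs0 : (0 : ℝ) ∈ s) (hg' : ContinuousOn g' s) (h0 : g' 0 = g 0)
    (hδ : δ ≤ 1 / 2) (hclose : ∀ t ∈ s, ‖g' t - g t‖ ≤ δ * ‖g t‖) :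
    ∀ t ∈ s, ‖distinguishedLog g' s t - L t‖ ≤ 3 / 2 * δ := by
  obtain ⟨L', hL', hbound⟩ := hL.exists_norm_sub_le hg' h0 hδ hclose
  intro t ht
  rw [(isDistinguishedLog_distinguishedLog ⟨L', hL'⟩).eqOn hs hs0 hL' ht]
  exact hbound t ht

end DistinguishedLog

section TruncatedInversion

/-- The Fourier inversion integral `(2π)⁻¹ ∫_{-T}^{T} e^{-itx} φ(t) dt`, cut at frequency `T`. -/
noncomputable def truncatedInversion (T : ℝ) (φ : ℝ → ℂ) (x : ℝ) : ℂ :=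
  1 / (2 * Real.pi) * ∫ t in (-T)..T, Complex.exp (-Complex.I * t * x) * φ t

theorem norm_exp_neg_I_mul_mul (t x : ℝ) : ‖Complex.exp (-Complex.I * t * x)‖ = 1 := by
  rw [show -Complex.I * t * x = ((-(t * x) : ℝ) : ℂ) * Complex.I by push_cast; ring]
  exact Complex.norm_exp_ofReal_mul_I _

variable {T c : ℝ} {φ ψ : ℝ → ℂ}

theorem truncatedInversion_sub (hT : 0 ≤ T) (hφ : ContinuousOn φ (Set.Icc (-T) T))
    (hψ : ContinuousOn ψ (Set.Icc (-T) T)) (x : ℝ) :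
    truncatedInversion T (φ - ψ) x = truncatedInversion T φ x - truncatedInversion T ψ x := by
  have hint : ∀ {χ : ℝ → ℂ}, ContinuousOn χ (Set.Icc (-T) T) → IntervalIntegrable
      (fun t : ℝ => Complex.exp (-Complex.I * t * x) * χ t) volume (-T) T := fun hχ => by
    rw [← Set.uIcc_of_le (by linarith)] at hχ
    exact (ContinuousOn.mul (by fun_prop) hχ).intervalIntegrable
  simp only [truncatedInversion, Pi.sub_apply, mul_sub,
    intervalIntegral.integral_sub (hint hφ) (hint hψ)]

theorem norm_truncatedInversion_le (hT : 0 ≤ T) (hφ : ∀ t ∈ Set.Icc (-T) T, ‖φ t‖ ≤ c) (x : ℝ) :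
    ‖truncatedInversion T φ x‖ ≤ T / Real.pi * c := by
  have hbound : ‖∫ t in (-T)..T, Complex.exp (-Complex.I * t * x) * φ t‖ ≤ c * |T - -T| := by
    refine intervalIntegral.norm_integral_le_of_norm_le_const fun t ht => ?_
    rw [Set.uIoc_of_le (by linarith)] at ht
    rw [norm_mul, norm_exp_neg_I_mul_mul, one_mul]
    exact hφ t (Set.Ioc_subset_Icc_self ht)
  rw [abs_of_nonneg (by linarith)] at hbound
  calc ‖truncatedInversion T φ x‖ ≤ 1 / (2 * Real.pi) * (c * (T - -T)) := by
        rw [truncatedInversion, norm_mul]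
        gcongr
        simp [abs_of_pos Real.pi_pos]
    _ = T / Real.pi * c := by
        field_simp
        ring

theorem truncatedInversion_const_mul (T : ℝ) (c : ℂ) (φ : ℝ → ℂ) (x : ℝ) :
    truncatedInversion T (fun t => c * φ t) x = c * truncatedInversion T φ x := by
  simp only [truncatedInversion, mul_left_comm _ c, intervalIntegral.integral_const_mul]

theorem IsDistinguishedLog.norm_truncatedInversion_sub_le {g g' L : ℝ → ℂ} {δ : ℝ} (hT : 0 ≤ T)
    (hL : IsDistinguishedLog g L (Set.Icc (-T) T)) (hg' : ContinuousOn g' (Set.Icc (-T) T))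
    (h0 : g' 0 = g 0) (hδ : δ ≤ 1 / 2)
    (hclose : ∀ t ∈ Set.Icc (-T) T, ‖g' t - g t‖ ≤ δ * ‖g t‖) (x : ℝ) :
    ‖truncatedInversion T (distinguishedLog g' (Set.Icc (-T) T)) x - truncatedInversion T L x‖ ≤
      T / Real.pi * (3 / 2 * δ) := by
  obtain ⟨L', hL', -⟩ := hL.exists_norm_sub_le hg' h0 hδ hclose
  rw [← truncatedInversion_sub hT (isDistinguishedLog_distinguishedLog ⟨L', hL'⟩).1 hL.1]
  exact norm_truncatedInversion_le hT (hL.norm_distinguishedLog_sub_le isPreconnected_Icc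
    ⟨by linarith, hT⟩ hg' h0 hδ hclose) x

end TruncatedInversion

section Estimator

variable {lam h : ℝ} {n : ℕ}

theorem continuous_empCharFun_uncurry (n : ℕ) :
    Continuous fun p : (Fin n → ℝ) × ℝ => empCharFun p.1 p.2 := by
  unfold empCharFun
  fun_prop

theorem continuous_empCharFun (xs : Fin n → ℝ) : Continuous (empCharFun xs) := by
  unfold empCharFun
  fun_prop

theorem fnhComplex_eq_inv_mul_truncatedInversion (lam h : ℝ) (xs : Fin n → ℝ) (x : ℝ) :
    fnhComplex lam h xs x = (lam : ℂ)⁻¹ * truncatedInversion (1 / h)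
      (distinguishedLog (plugInRatio lam h xs) (Set.Icc (-(1 / h)) (1 / h))) x := by
  rw [fnhComplex, truncatedInversion]
  ring

theorem sincKernelFT_mul_eq_one {t : ℝ} (hh : 0 < h) (ht : t ∈ Set.Icc (-(1 / h)) (1 / h)) :
    sincKernelFT (h * t) = 1 := by
  have h1 : h * (1 / h) = 1 := by field_simp
  refine Set.indicator_of_mem (s := Set.Icc (-1 : ℝ) 1) ⟨?_, ?_⟩ _
  · nlinarith [mul_le_mul_of_nonneg_left ht.1 hh.le]
  · nlinarith [mul_le_mul_of_nonneg_left ht.2 hh.le]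

theorem plugInRatio_eq_div {t : ℝ} (hh : 0 < h) (ht : t ∈ Set.Icc (-(1 / h)) (1 / h))
    (xs : Fin n → ℝ) :
    plugInRatio lam h xs t =
      empCharFun xs t / (Complex.exp (-(lam : ℂ)) * Complex.exp (-(t : ℂ) ^ 2 / 2)) := by
  rw [plugInRatio, sincKernelFT_mul_eq_one hh ht, Complex.ofReal_one, mul_one]

theorem plugInRatio_zero_eq (lam h : ℝ) (xs xs' : Fin n → ℝ) :
    plugInRatio lam h xs 0 = plugInRatio lam h xs' 0 := by
  simp [plugInRatio, empCharFun]

theorem continuousOn_plugInRatio (lam : ℝ) (hh : 0 < h) (xs : Fin n → ℝ) :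
    ContinuousOn (plugInRatio lam h xs) (Set.Icc (-(1 / h)) (1 / h)) := by
  refine ContinuousOn.congr (ContinuousOn.div (continuous_empCharFun xs).continuousOn
    (by fun_prop) fun t _ => ?_) fun t ht => plugInRatio_eq_div hh ht xs
  exact mul_ne_zero (Complex.exp_ne_zero _) (Complex.exp_ne_zero _)

theorem eventually_norm_plugInRatio_sub_le {xs : Fin n → ℝ} {δ : ℝ} (hh : 0 < h)
    (hne : ∀ t ∈ Set.Icc (-(1 / h)) (1 / h), plugInRatio lam h xs t ≠ 0) (hδ : 0 < δ) :
    ∀ᶠ xs' in nhds xs, ∀ t ∈ Set.Icc (-(1 / h)) (1 / h),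
      ‖plugInRatio lam h xs' t - plugInRatio lam h xs t‖ ≤ δ * ‖plugInRatio lam h xs t‖ := by
  have hemp : ∀ᶠ xs' in nhds xs, ∀ t ∈ Set.Icc (-(1 / h)) (1 / h),
      ‖empCharFun xs' t - empCharFun xs t‖ < δ * ‖empCharFun xs t‖ := by
    refine isCompact_Icc.eventually_forall_of_forall_eventually fun t ht => ?_
    have hcont : Continuous fun p : (Fin n → ℝ) × ℝ => empCharFun xs p.2 :=
      (continuous_empCharFun xs).comp continuous_snd
    refine (isOpen_lt ((continuous_empCharFun_uncurry n).sub hcont).norm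
      (hcont.norm.const_mul δ)).mem_nhds ?_
    have : empCharFun xs t ≠ 0 := fun h0 => hne t ht (by
      rw [plugInRatio_eq_div hh ht, h0, zero_div])
    simpa using mul_pos hδ (norm_pos_iff.2 this)
  filter_upwards [hemp] with xs' hxs' t ht
  rw [plugInRatio_eq_div hh ht, plugInRatio_eq_div hh ht, ← sub_div, norm_div, norm_div,
    ← mul_div_assoc]
  gcongr
  exact (hxs' t ht).le

/-- The samples for which the distinguished logarithm in the definition of the estimator exists. Off
this open set the estimator is `0`, so it is measurable but in general discontinuous in the
sample. -/
def loggableSamples (lam h : ℝ) (n : ℕ) : Set (Fin n → ℝ) :=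
  {xs | ∃ L, IsDistinguishedLog (plugInRatio lam h xs) L (Set.Icc (-(1 / h)) (1 / h))}

theorem fnhComplex_eq_zero_of_notMem {xs : Fin n → ℝ} (hxs : xs ∉ loggableSamples lam h n)
    (x : ℝ) : fnhComplex lam h xs x = 0 := by
  have hlog : distinguishedLog (plugInRatio lam h xs) (Set.Icc (-(1 / h)) (1 / h)) = 0 :=
    dif_neg hxs
  simp only [fnhComplex, hlog, Pi.zero_apply, mul_zero, intervalIntegral.integral_zero]

theorem isOpen_loggableSamples (lam : ℝ) (hh : 0 < h) (n : ℕ) :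
    IsOpen (loggableSamples lam h n) := by
  refine isOpen_iff_mem_nhds.2 fun xs ⟨L, hL⟩ => ?_
  filter_upwards [eventually_norm_plugInRatio_sub_le hh (fun t ht => hL.ne_zero ht) one_half_pos]
    with xs' hxs'
  obtain ⟨L', hL', -⟩ := hL.exists_norm_sub_le (continuousOn_plugInRatio lam hh xs')
    (plugInRatio_zero_eq lam h xs' xs) le_rfl hxs'
  exact ⟨L', hL'⟩

theorem continuousOn_fnhComplex (lam : ℝ) (hh : 0 < h) (x : ℝ) :
    ContinuousOn (fun xs : Fin n → ℝ => fnhComplex lam h xs x) (loggableSamples lam h n) := by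
  simp only [fnhComplex_eq_inv_mul_truncatedInversion]
  intro xs hxs
  refine ContinuousAt.continuousWithinAt (.const_mul (Metric.tendsto_nhds.2 fun ε hε => ?_) _)
  have hL := isDistinguishedLog_distinguishedLog hxs
  have hT : 0 < 1 / h := by positivity
  set c := 1 / h / Real.pi * (3 / 2)
  have hc : 0 < c := by positivity
  filter_upwards [eventually_norm_plugInRatio_sub_le hh (fun t ht => hL.ne_zero ht)
    (show 0 < min (1 / 2) (ε / (2 * c)) by positivity)] with xs' hxs'
  calc dist _ _ ≤ 1 / h / Real.pi * (3 / 2 * min (1 / 2) (ε / (2 * c))) := by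
        rw [dist_eq_norm]
        exact hL.norm_truncatedInversion_sub_le hT.le (continuousOn_plugInRatio lam hh xs')
          (plugInRatio_zero_eq lam h xs' xs) (min_le_left _ _) hxs' x
    _ = c * min (1 / 2) (ε / (2 * c)) := (mul_assoc _ _ _).symm
    _ ≤ c * (ε / (2 * c)) := by
        gcongr
        exact min_le_right _ _
    _ = ε / 2 := by field_simp
    _ < ε := half_lt_self hε

theorem measurable_fnhComplex (lam : ℝ) (hh : 0 < h) (n : ℕ) (x : ℝ) :
    Measurable fun xs : Fin n → ℝ => fnhComplex lam h xs x := by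
  classical
  have hpiecewise : (fun xs : Fin n → ℝ => fnhComplex lam h xs x) =
      (loggableSamples lam h n).piecewise (fun xs => fnhComplex lam h xs x) 0 := by
    rw [Set.piecewise_eq_indicator, Set.indicator_eq_self.2]
    exact fun xs hxs => not_not.1 fun hn => hxs (fnhComplex_eq_zero_of_notMem hn x)
  rw [hpiecewise]
  exact (continuousOn_fnhComplex lam hh x).measurable_piecewise continuousOn_const
    (isOpen_loggableSamples lam hh n).measurableSet

theorem measurable_fHat (lam : ℝ) (hh : 0 < h) (M : ℝ) (n : ℕ) (x : ℝ) :
    Measurable fun xs : Fin n → ℝ => fHat lam h M xs x :=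
  (measurable_const.min (Complex.measurable_re.comp
    (measurable_fnhComplex lam hh n x))).max measurable_const

theorem abs_fHat_le (lam h M : ℝ) (xs : Fin n → ℝ) (x : ℝ) : |fHat lam h M xs x| ≤ |M| :=
  abs_le.2 ⟨(neg_le_neg (le_abs_self M)).trans (le_max_right _ _),
    max_le ((min_le_left _ _).trans (le_abs_self M)) (neg_le_abs M)⟩

theorem abs_fHat_sub_le (lam h : ℝ) {M a : ℝ} (ha : |a| ≤ M) (xs : Fin n → ℝ) (x : ℝ) :
    |fHat lam h M xs x - a| ≤ |fnh lam h xs x - a| := by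
  obtain ⟨hlower, hupper⟩ := abs_le.1 ha
  calc |fHat lam h M xs x - a|
      = |max (min M (fnh lam h xs x)) (-M) - max (min M a) (-M)| := by
        rw [min_eq_right hupper, max_eq_left hlower, fHat]
    _ ≤ |min M (fnh lam h xs x) - min M a| := abs_max_sub_max_le_abs _ _ _
    _ ≤ |fnh lam h xs x - a| := (abs_min_sub_min_le_max _ _ _ _).trans (by simp)

end Estimator

section CompoundPoisson

variable (lam : ℝ≥0) (F : Measure ℝ) [IsProbabilityMeasure F]

instance isProbabilityMeasure_compoundPoisson : IsProbabilityMeasure (compoundPoisson lam F) :=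
  Measure.isProbabilityMeasure_map measurable_randomSum.aemeasurable

theorem integral_exp_sum_infinitePi (k : ℕ) (t : ℝ) :
    ∫ w : ℕ → ℝ, Complex.exp (t * ((∑ j ∈ Finset.range k, w j : ℝ) : ℂ) * Complex.I)
      ∂(Measure.infinitePi fun _ : ℕ => F) = charFun F t ^ k := by
  have hind : iIndepFun (fun (j : ℕ) (w : ℕ → ℝ) => w j) (Measure.infinitePi fun _ : ℕ => F) :=
    iIndepFun_infinitePi (X := fun _ y => y) fun _ => measurable_id
  have hprod := congrFun (iIndepFun.charFun_map_fun_finsetSum_eq_prod (s := Finset.range k)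
    (fun i _ => (measurable_pi_apply i).aemeasurable) (hind.restrict _)) t
  rw [charFun_apply_real, integral_map (by fun_prop) (by fun_prop)] at hprod
  simpa [Measure.infinitePi_map_eval] using hprod

theorem charFun_compoundPoisson (t : ℝ) :
    charFun (compoundPoisson lam F) t = Complex.exp (lam * (charFun F t - 1)) := by
  have hsum := measurable_randomSum
  have hint : Integrable (fun p : ℕ × (ℕ → ℝ) =>
      Complex.exp (t * ((∑ j ∈ Finset.range p.1, p.2 j : ℝ) : ℂ) * Complex.I))
      ((poissonMeasure lam).prod (Measure.infinitePi fun _ : ℕ => F)) := by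
    refine Integrable.of_bound (C := 1) ?_ (ae_of_all _ fun p => ?_)
    · exact (Complex.measurable_exp.comp (((Complex.measurable_ofReal.comp hsum).const_mul
        (t : ℂ)).mul_const Complex.I)).aestronglyMeasurable
    · rw [← Complex.ofReal_mul, Complex.norm_exp_ofReal_mul_I]
  rw [charFun_apply_real, compoundPoisson, integral_map hsum.aemeasurable (by fun_prop),
    integral_prod _ hint]
  simp only [integral_exp_sum_infinitePi]
  rw [integral_poissonMeasure]
  have hexp := ((NormedSpace.expSeries_div_hasSum_exp ((lam : ℂ) * charFun F t)).mul_left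
    (Complex.exp (-(lam : ℂ)))).tsum_eq
  rw [← Complex.exp_eq_exp_ℂ, ← Complex.exp_add] at hexp
  rw [show (lam : ℂ) * (charFun F t - 1) = -lam + lam * charFun F t by ring, ← hexp]
  congr 1 with k
  rw [Complex.real_smul]
  push_cast
  ring

theorem integrable_natCast_poissonMeasure :
    Integrable (fun k : ℕ => (k : ℝ)) (poissonMeasure lam) := by
  rw [integrable_poissonMeasure_iff, ← summable_nat_add_iff 1]
  refine ((Real.summable_pow_div_factorial lam).mul_left (Real.exp (-lam) * lam)).congr fun k => ?_
  rw [Nat.factorial_succ, Real.norm_of_nonneg (by positivity)]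
  push_cast
  field_simp
  ring

theorem integral_norm_sum_infinitePi_le (hF : Integrable (fun y : ℝ => y) F) (k : ℕ) :
    ∫ w : ℕ → ℝ, ‖∑ j ∈ Finset.range k, w j‖ ∂(Measure.infinitePi fun _ : ℕ => F) ≤
      k * ∫ y, ‖y‖ ∂F := by
  have heval := measurePreserving_eval_infinitePi fun _ : ℕ => F
  have hint : ∀ j : ℕ, Integrable (fun w : ℕ → ℝ => w j) (Measure.infinitePi fun _ : ℕ => F) :=
    fun j => (heval j).integrable_comp_of_integrable hF
  have hnorm : ∀ j : ℕ, ∫ w : ℕ → ℝ, ‖w j‖ ∂(Measure.infinitePi fun _ : ℕ => F) =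
      ∫ y, ‖y‖ ∂F := fun j => by
    conv_rhs => rw [← (heval j).map_eq]
    exact (integral_map (heval j).aemeasurable (by fun_prop)).symm
  calc ∫ w : ℕ → ℝ, ‖∑ j ∈ Finset.range k, w j‖ ∂(Measure.infinitePi fun _ : ℕ => F)
      ≤ ∫ w : ℕ → ℝ, ∑ j ∈ Finset.range k, ‖w j‖ ∂(Measure.infinitePi fun _ : ℕ => F) :=
        integral_mono (integrable_finsetSum _ fun j _ => hint j).norm
          (integrable_finsetSum _ fun j _ => (hint j).norm) fun w => norm_sum_le _ _
    _ = k * ∫ y, ‖y‖ ∂F := by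
        rw [integral_finsetSum _ fun j _ => (hint j).norm]
        simp only [hnorm, Finset.sum_const, Finset.card_range, nsmul_eq_mul]

variable {F} in
theorem integrable_id_compoundPoisson (hF : Integrable (fun y : ℝ => y) F) :
    Integrable (fun y : ℝ => y) (compoundPoisson lam F) := by
  have hsum := measurable_randomSum
  rw [compoundPoisson, integrable_map_measure (by fun_prop) hsum.aemeasurable]
  refine (integrable_prod_iff hsum.aestronglyMeasurable).2 ⟨ae_of_all _ fun k => ?_, ?_⟩
  · exact integrable_finsetSum (Finset.range k) fun j _ =>
      (measurePreserving_eval_infinitePi (fun _ : ℕ => F) j).integrable_comp_of_integrable hF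
  · refine ((integrable_natCast_poissonMeasure lam).mul_const (∫ y, ‖y‖ ∂F)).mono'
      .of_discrete (ae_of_all _ fun k => ?_)
    rw [Real.norm_of_nonneg (integral_nonneg fun _ => norm_nonneg _)]
    exact integral_norm_sum_infinitePi_le F hF k

/-- The law of the observations `X_i = Y_i + Z_i`: a compound Poisson law plus independent standard
normal noise. -/
noncomputable def observationLaw : Measure ℝ := compoundPoisson lam F ∗ gaussianReal 0 1

instance isProbabilityMeasure_observationLaw : IsProbabilityMeasure (observationLaw lam F) := by
  unfold observationLaw
  infer_instance

theorem charFun_observationLaw (t : ℝ) :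
    charFun (observationLaw lam F) t = Complex.exp (lam * charFun F t) *
      (Complex.exp (-((lam : ℝ) : ℂ)) * Complex.exp (-(t : ℂ) ^ 2 / 2)) := by
  rw [observationLaw, charFun_conv, charFun_compoundPoisson, charFun_gaussianReal,
    ← Complex.exp_add, ← Complex.exp_add, ← Complex.exp_add]
  congr 1
  push_cast
  ring

variable {F} in
theorem integrable_id_observationLaw (hF : Integrable (fun y : ℝ => y) F) :
    Integrable (fun y : ℝ => y) (observationLaw lam F) := by
  have hgaussian : Integrable (fun y : ℝ => y) (gaussianReal 0 1) :=
    (memLp_id_gaussianReal 1).integrable le_rfl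
  rw [observationLaw, Measure.conv, integrable_map_measure (by fun_prop) (by fun_prop)]
  exact ((integrable_id_compoundPoisson lam hF).comp_fst _).add (hgaussian.comp_snd _)

end CompoundPoisson

section SampleMean

variable {α : Type*} [MeasurableSpace α] {μ : Measure α} [IsProbabilityMeasure μ] {u : α → ℝ}
  {n : ℕ}

theorem variance_sampleMean (hu : MemLp u 2 μ) (n : ℕ) :
    Var[fun xs : Fin n → α => 1 / (n : ℝ) * ∑ j, u (xs j); Measure.pi fun _ => μ] =
      Var[u; μ] / n := by
  have hsum := variance_sum_pi (μ := fun _ : Fin n => μ) (X := fun _ => u) fun _ => hu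
  rw [variance_const_mul, ← Finset.sum_fn, hsum, Finset.sum_const, Finset.card_univ,
    Fintype.card_fin, nsmul_eq_mul]
  rcases eq_or_ne n 0 with rfl | hn
  · simp
  · field_simp

theorem integrable_sampleMean (hu : Integrable u μ) (n : ℕ) :
    Integrable (fun xs : Fin n → α => 1 / (n : ℝ) * ∑ j, u (xs j)) (Measure.pi fun _ => μ) :=
  (integrable_finsetSum _ fun _ _ => integrable_comp_eval hu).const_mul _

theorem integral_sampleMean (hu : Integrable u μ) (hn : n ≠ 0) :
    ∫ xs : Fin n → α, 1 / (n : ℝ) * ∑ j, u (xs j) ∂(Measure.pi fun _ => μ) = ∫ y, u y ∂μ := by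
  rw [integral_const_mul, integral_finsetSum _ fun j _ => integrable_comp_eval hu]
  simp only [integral_comp_eval (μ := fun _ : Fin n => μ) hu.aestronglyMeasurable,
    Finset.sum_const, Finset.card_univ, Fintype.card_fin, nsmul_eq_mul]
  field_simp

theorem memLp_sampleMean (hu : MemLp u 2 μ) (n : ℕ) :
    MemLp (fun xs : Fin n → α => 1 / (n : ℝ) * ∑ j, u (xs j)) 2 (Measure.pi fun _ => μ) :=
  (memLp_finsetSum _ fun j _ =>
    hu.comp_measurePreserving (measurePreserving_eval (fun _ : Fin n => μ) j)).const_mul _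

theorem integral_sq_sampleMean_sub (hu : MemLp u 2 μ) (hn : n ≠ 0) :
    ∫ xs : Fin n → α, (1 / (n : ℝ) * ∑ j, u (xs j) - ∫ y, u y ∂μ) ^ 2 ∂(Measure.pi fun _ => μ) =
      Var[u; μ] / n := by
  rw [← variance_sampleMean hu, variance_eq_integral (memLp_sampleMean hu n).aemeasurable,
    integral_sampleMean (hu.integrable one_le_two) hn]

end SampleMean

section EmpiricalCharFun

variable {n : ℕ}

theorem empCharFun_eq_sum_exp_mul_I (xs : Fin n → ℝ) (t : ℝ) :
    empCharFun xs t = ((1 / (n : ℝ) : ℝ) : ℂ) * ∑ j, Complex.exp ((t * xs j : ℝ) * Complex.I) := by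
  unfold empCharFun
  push_cast
  refine congrArg _ (Finset.sum_congr rfl fun j _ => congrArg _ ?_)
  ring

theorem re_empCharFun (xs : Fin n → ℝ) (t : ℝ) :
    (empCharFun xs t).re = 1 / (n : ℝ) * ∑ j, Real.cos (t * xs j) := by
  rw [empCharFun_eq_sum_exp_mul_I, Complex.re_ofReal_mul, Complex.re_sum]
  simp only [Complex.exp_ofReal_mul_I_re]

theorem im_empCharFun (xs : Fin n → ℝ) (t : ℝ) :
    (empCharFun xs t).im = 1 / (n : ℝ) * ∑ j, Real.sin (t * xs j) := by
  rw [empCharFun_eq_sum_exp_mul_I, Complex.im_ofReal_mul, Complex.im_sum]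
  simp only [Complex.exp_ofReal_mul_I_im]

theorem norm_empCharFun_le_one (xs : Fin n → ℝ) (t : ℝ) : ‖empCharFun xs t‖ ≤ 1 := by
  rw [empCharFun_eq_sum_exp_mul_I, norm_mul, Complex.norm_real, Real.norm_of_nonneg (by positivity)]
  calc 1 / (n : ℝ) * ‖∑ j, Complex.exp ((t * xs j : ℝ) * Complex.I)‖
      ≤ 1 / (n : ℝ) * ∑ j, ‖Complex.exp ((t * xs j : ℝ) * Complex.I)‖ := by
        gcongr
        exact norm_sum_le _ _
    _ = (n : ℝ) / n := by
        simp [Complex.norm_exp_ofReal_mul_I, ← div_eq_inv_mul, -Complex.ofReal_mul]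
    _ ≤ 1 := div_self_le_one _

theorem norm_exp_mul_I_sub_le (a b : ℝ) :
    ‖Complex.exp (a * Complex.I) - Complex.exp (b * Complex.I)‖ ≤ |a - b| := by
  have hfactor : Complex.exp (a * Complex.I) - Complex.exp (b * Complex.I) =
      Complex.exp (b * Complex.I) * (Complex.exp (Complex.I * ((a - b : ℝ) : ℂ)) - 1) := by
    rw [mul_sub, ← Complex.exp_add, mul_one]
    congr 2
    push_cast
    ring
  rw [hfactor, norm_mul, Complex.norm_exp_ofReal_mul_I, one_mul]
  exact Real.norm_exp_I_mul_ofReal_sub_one_le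

theorem norm_empCharFun_sub_empCharFun_le (xs : Fin n → ℝ) (t s : ℝ) :
    ‖empCharFun xs t - empCharFun xs s‖ ≤ 1 / (n : ℝ) * (∑ j, |xs j|) * |t - s| := by
  rw [empCharFun_eq_sum_exp_mul_I, empCharFun_eq_sum_exp_mul_I, ← mul_sub, norm_mul,
    Complex.norm_real, Real.norm_of_nonneg (by positivity), ← Finset.sum_sub_distrib, mul_assoc,
    Finset.sum_mul]
  gcongr
  refine (norm_sum_le _ _).trans (Finset.sum_le_sum fun j _ => ?_)
  refine (norm_exp_mul_I_sub_le _ _).trans_eq ?_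
  rw [← sub_mul, abs_mul, mul_comm]

variable (μ : Measure ℝ)

theorem integrable_exp_mul_mul_I [IsFiniteMeasure μ] (t : ℝ) :
    Integrable (fun y : ℝ => Complex.exp (t * y * Complex.I)) μ := by
  refine Integrable.of_bound (C := 1) (by fun_prop) (ae_of_all _ fun y => ?_)
  rw [← Complex.ofReal_mul, Complex.norm_exp_ofReal_mul_I]

theorem re_charFun [IsFiniteMeasure μ] (t : ℝ) :
    (charFun μ t).re = ∫ y, Real.cos (t * y) ∂μ := by
  rw [charFun_apply_real, ← RCLike.re_to_complex, ← integral_re (integrable_exp_mul_mul_I μ t)]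
  congr 1 with y
  rw [← Complex.ofReal_mul, RCLike.re_to_complex, Complex.exp_ofReal_mul_I_re]

theorem im_charFun [IsFiniteMeasure μ] (t : ℝ) :
    (charFun μ t).im = ∫ y, Real.sin (t * y) ∂μ := by
  rw [charFun_apply_real, ← RCLike.im_to_complex, ← integral_im (integrable_exp_mul_mul_I μ t)]
  congr 1 with y
  rw [← Complex.ofReal_mul, RCLike.im_to_complex, Complex.exp_ofReal_mul_I_im]

variable {μ} in
theorem norm_charFun_sub_charFun_le [IsFiniteMeasure μ] (hμ : Integrable (fun y : ℝ => y) μ)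
    (t s : ℝ) : ‖charFun μ t - charFun μ s‖ ≤ (∫ y, |y| ∂μ) * |t - s| := by
  rw [charFun_apply_real, charFun_apply_real, ← integral_sub (integrable_exp_mul_mul_I μ t)
    (integrable_exp_mul_mul_I μ s), ← integral_mul_const]
  refine norm_integral_le_of_norm_le (hμ.abs.mul_const _) (ae_of_all _ fun y => ?_)
  rw [← Complex.ofReal_mul, ← Complex.ofReal_mul]
  refine (norm_exp_mul_I_sub_le _ _).trans_eq ?_
  rw [← sub_mul, abs_mul, mul_comm]

variable [IsProbabilityMeasure μ]

theorem continuous_norm_empCharFun_sub_charFun (n : ℕ) :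
    Continuous fun p : (Fin n → ℝ) × ℝ => ‖empCharFun p.1 p.2 - charFun μ p.2‖ :=
  ((continuous_empCharFun_uncurry n).sub (continuous_charFun.comp continuous_snd)).norm

theorem norm_empCharFun_sub_charFun_le_two (xs : Fin n → ℝ) (t : ℝ) :
    ‖empCharFun xs t - charFun μ t‖ ≤ 2 :=
  (norm_sub_le_of_le (norm_empCharFun_le_one xs t) (norm_charFun_le_one t)).trans_eq
    one_add_one_eq_two

theorem memLp_norm_empCharFun_sub_charFun (n : ℕ) (t : ℝ) :
    MemLp (fun xs : Fin n → ℝ => ‖empCharFun xs t - charFun μ t‖) 2 (Measure.pi fun _ => μ) :=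
  MemLp.of_bound ((continuous_norm_empCharFun_sub_charFun μ n).comp
    (Continuous.prodMk_left t)).aestronglyMeasurable 2 (ae_of_all _ fun xs => by
      rw [norm_norm]
      exact norm_empCharFun_sub_charFun_le_two μ xs t)

theorem integral_sq_norm_empCharFun_sub_charFun (hn : n ≠ 0) (t : ℝ) :
    ∫ xs : Fin n → ℝ, ‖empCharFun xs t - charFun μ t‖ ^ 2 ∂(Measure.pi fun _ => μ) =
      (1 - ‖charFun μ t‖ ^ 2) / n := by
  have hcos : MemLp (fun y => Real.cos (t * y)) 2 μ :=
    MemLp.of_bound (by fun_prop) 1 (ae_of_all _ fun y => Real.abs_cos_le_one _)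
  have hsin : MemLp (fun y => Real.sin (t * y)) 2 μ :=
    MemLp.of_bound (by fun_prop) 1 (ae_of_all _ fun y => Real.abs_sin_le_one _)
  have hnormSq : ∀ xs : Fin n → ℝ, ‖empCharFun xs t - charFun μ t‖ ^ 2 =
      (1 / (n : ℝ) * ∑ j, Real.cos (t * xs j) - ∫ y, Real.cos (t * y) ∂μ) ^ 2 +
      (1 / (n : ℝ) * ∑ j, Real.sin (t * xs j) - ∫ y, Real.sin (t * y) ∂μ) ^ 2 := fun xs => by
    rw [← Complex.normSq_eq_norm_sq, Complex.normSq_apply, Complex.sub_re, Complex.sub_im,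
      re_empCharFun, im_empCharFun, re_charFun, im_charFun]
    ring
  have hvar : Var[fun y => Real.cos (t * y); μ] + Var[fun y => Real.sin (t * y); μ] =
      1 - ‖charFun μ t‖ ^ 2 := by
    have hsq : ∫ y, Real.cos (t * y) ^ 2 ∂μ + ∫ y, Real.sin (t * y) ^ 2 ∂μ = 1 := by
      rw [← integral_add hcos.integrable_sq hsin.integrable_sq]
      simp
    rw [variance_eq_sub hcos, variance_eq_sub hsin, ← Complex.normSq_eq_norm_sq,
      Complex.normSq_apply, re_charFun, im_charFun]
    simp only [Pi.pow_apply]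
    linarith
  simp only [hnormSq]
  rw [integral_add, integral_sq_sampleMean_sub hcos hn, integral_sq_sampleMean_sub hsin hn,
    ← add_div, hvar]
  · exact ((memLp_sampleMean hcos n).sub (memLp_const _)).integrable_sq
  · exact ((memLp_sampleMean hsin n).sub (memLp_const _)).integrable_sq

theorem integral_norm_empCharFun_sub_charFun_le (hn : n ≠ 0) (t : ℝ) :
    ∫ xs : Fin n → ℝ, ‖empCharFun xs t - charFun μ t‖ ∂(Measure.pi fun _ => μ) ≤ 1 / √n := by
  have hvar := variance_nonneg (fun xs : Fin n → ℝ => ‖empCharFun xs t - charFun μ t‖)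
    (Measure.pi fun _ => μ)
  rw [variance_eq_sub (memLp_norm_empCharFun_sub_charFun μ n t)] at hvar
  simp only [Pi.pow_apply, integral_sq_norm_empCharFun_sub_charFun μ hn t] at hvar
  rw [← Real.sqrt_one, ← Real.sqrt_div zero_le_one]
  refine Real.le_sqrt_of_sq_le ((sub_nonneg.1 hvar).trans ?_)
  gcongr
  exact sub_le_self _ (sq_nonneg _)

end EmpiricalCharFun

section SupDeviation

theorem norm_le_mul_add_average {E : Type*} [NormedAddCommGroup E] {G : ℝ → E} {K T w t₀ : ℝ}
    (hG : ∀ t s, ‖G t - G s‖ ≤ K * |t - s|) (hw : 0 < w) (ht₀ : t₀ ∈ Set.Icc (-T) T) :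
    ‖G t₀‖ ≤ K * w + (2 * w)⁻¹ * ∫ t in (-(T + w))..(T + w), ‖G t‖ := by
  have hK : 0 ≤ K := by simpa using (norm_nonneg _).trans (hG 1 0)
  have hcont : Continuous G := (LipschitzWith.of_dist_le' fun t s => by
    simpa only [dist_eq_norm, Real.norm_eq_abs] using hG t s).continuous
  have hint : ∀ a b : ℝ, IntervalIntegrable (fun t => ‖G t‖) volume a b := fun a b =>
    hcont.norm.intervalIntegrable a b
  have hlower : ∫ _t in (t₀ - w)..(t₀ + w), (‖G t₀‖ - K * w) ≤
      ∫ t in (t₀ - w)..(t₀ + w), ‖G t‖ := by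
    refine intervalIntegral.integral_mono_on (by linarith) (by simp) (hint _ _) fun t ht => ?_
    have hdist : |t₀ - t| ≤ w := abs_le.2 ⟨by linarith [ht.2], by linarith [ht.1]⟩
    have := (norm_sub_norm_le _ _).trans ((hG t₀ t).trans (mul_le_mul_of_nonneg_left hdist hK))
    linarith
  have hupper : ∫ t in (t₀ - w)..(t₀ + w), ‖G t‖ ≤ ∫ t in (-(T + w))..(T + w), ‖G t‖ :=
    intervalIntegral.integral_mono_interval (by linarith [ht₀.1]) (by linarith)
      (by linarith [ht₀.2]) (ae_of_all _ fun t => norm_nonneg _) (hint _ _)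
  rw [intervalIntegral.integral_const, smul_eq_mul, show t₀ + w - (t₀ - w) = 2 * w by ring]
    at hlower
  rw [← sub_le_iff_le_add', inv_mul_eq_div, le_div_iff₀' (by positivity)]
  exact hlower.trans hupper

/-- The largest deviation, over frequencies `|t| ≤ T`, of the empirical characteristic function of a
sample from the characteristic function of `μ`. -/
noncomputable def supDeviation (μ : Measure ℝ) (T : ℝ) {n : ℕ} (xs : Fin n → ℝ) : ℝ :=
  sSup ((fun t => ‖empCharFun xs t - charFun μ t‖) '' Set.Icc (-T) T)

theorem supDeviation_nonneg (μ : Measure ℝ) (T : ℝ) {n : ℕ} (xs : Fin n → ℝ) :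
    0 ≤ supDeviation μ T xs :=
  Real.sSup_nonneg (Set.forall_mem_image.2 fun _ _ => norm_nonneg _)

variable (μ : Measure ℝ) [IsProbabilityMeasure μ] {n : ℕ} {T : ℝ}

theorem continuous_supDeviation (T : ℝ) (n : ℕ) :
    Continuous fun xs : Fin n → ℝ => supDeviation μ T xs :=
  isCompact_Icc.continuous_sSup (continuous_norm_empCharFun_sub_charFun μ n)

theorem norm_empCharFun_sub_charFun_le_supDeviation (xs : Fin n → ℝ) {t : ℝ}
    (ht : t ∈ Set.Icc (-T) T) : ‖empCharFun xs t - charFun μ t‖ ≤ supDeviation μ T xs :=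
  le_csSup ⟨2, Set.forall_mem_image.2 fun s _ => norm_empCharFun_sub_charFun_le_two μ xs s⟩
    (Set.mem_image_of_mem _ ht)

theorem integrable_supDeviation (T : ℝ) (n : ℕ) :
    Integrable (fun xs : Fin n → ℝ => supDeviation μ T xs) (Measure.pi fun _ => μ) := by
  refine Integrable.of_bound (C := 2) (continuous_supDeviation μ T n).aestronglyMeasurable
    (ae_of_all _ fun xs => ?_)
  rw [Real.norm_of_nonneg (supDeviation_nonneg μ T xs)]
  exact Real.sSup_le (Set.forall_mem_image.2 fun t _ => norm_empCharFun_sub_charFun_le_two μ xs t)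
    zero_le_two

theorem integrable_uncurry_norm_empCharFun_sub_charFun (n : ℕ) (a b : ℝ) :
    Integrable (Function.uncurry fun (xs : Fin n → ℝ) (t : ℝ) => ‖empCharFun xs t - charFun μ t‖)
      ((Measure.pi fun _ => μ).prod (volume.restrict (Set.Ioc a b))) := by
  refine Integrable.of_bound (C := 2)
    (continuous_norm_empCharFun_sub_charFun μ n).aestronglyMeasurable (ae_of_all _ fun p => ?_)
  rw [Function.uncurry, norm_norm]
  exact norm_empCharFun_sub_charFun_le_two μ p.1 p.2

theorem integrable_intervalIntegral_norm_empCharFun_sub_charFun (n : ℕ) {S : ℝ} (hS : 0 ≤ S) :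
    Integrable (fun xs : Fin n → ℝ => ∫ t in (-S)..S, ‖empCharFun xs t - charFun μ t‖)
      (Measure.pi fun _ => μ) := by
  simp only [intervalIntegral.integral_of_le (neg_le_self hS)]
  exact (integrable_uncurry_norm_empCharFun_sub_charFun μ n _ _).integral_prod_left

theorem integral_intervalIntegral_norm_empCharFun_sub_charFun_le (hn : n ≠ 0) {S : ℝ}
    (hS : 0 ≤ S) :
    ∫ xs : Fin n → ℝ, (∫ t in (-S)..S, ‖empCharFun xs t - charFun μ t‖) ∂(Measure.pi fun _ => μ) ≤
      2 * S / √n := by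
  have hint := integrable_uncurry_norm_empCharFun_sub_charFun μ n (-S) S
  simp only [intervalIntegral.integral_of_le (neg_le_self hS)]
  rw [integral_integral_swap hint]
  calc _ ≤ ∫ _t in Set.Ioc (-S) S, 1 / √n :=
        integral_mono hint.integral_prod_right (integrable_const _) fun t =>
          integral_norm_empCharFun_sub_charFun_le μ hn t
    _ = 2 * S / √n := by
        rw [setIntegral_const, measureReal_def, Real.volume_Ioc,
          ENNReal.toReal_ofReal (by linarith), smul_eq_mul]
        ring

variable {μ}

theorem supDeviation_le (hμ : Integrable (fun y : ℝ => y) μ) (hT : 0 ≤ T) {w : ℝ} (hw : 0 < w)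
    (xs : Fin n → ℝ) :
    supDeviation μ T xs ≤ (1 / (n : ℝ) * ∑ j, |xs j| + ∫ y, |y| ∂μ) * w +
      (2 * w)⁻¹ * ∫ t in (-(T + w))..(T + w), ‖empCharFun xs t - charFun μ t‖ := by
  have hne : (Set.Icc (-T) T).Nonempty := ⟨0, by linarith, hT⟩
  refine csSup_le (hne.image _) (Set.forall_mem_image.2 fun t ht => ?_)
  refine norm_le_mul_add_average (G := fun t => empCharFun xs t - charFun μ t)
    (fun t s => ?_) hw ht
  rw [sub_sub_sub_comm, add_mul]
  exact norm_sub_le_of_le (norm_empCharFun_sub_empCharFun_le xs t s)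
    (norm_charFun_sub_charFun_le hμ t s)

theorem integral_supDeviation_le (hμ : Integrable (fun y : ℝ => y) μ) (hT : 0 ≤ T) {w : ℝ}
    (hw : 0 < w) (hn : n ≠ 0) :
    ∫ xs : Fin n → ℝ, supDeviation μ T xs ∂(Measure.pi fun _ => μ) ≤
      2 * (∫ y, |y| ∂μ) * w + (T + w) / (w * √n) := by
  have hS : 0 ≤ T + w := by positivity
  have hmean := integrable_sampleMean hμ.abs n
  have hlipschitz : Integrable (fun xs : Fin n → ℝ =>
      (1 / (n : ℝ) * ∑ j, |xs j| + ∫ y, |y| ∂μ) * w) (Measure.pi fun _ => μ) :=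
    (hmean.add (integrable_const _)).mul_const w
  have haverage := integrable_intervalIntegral_norm_empCharFun_sub_charFun μ n hS
  calc ∫ xs : Fin n → ℝ, supDeviation μ T xs ∂(Measure.pi fun _ => μ)
      ≤ ∫ xs : Fin n → ℝ, ((1 / (n : ℝ) * ∑ j, |xs j| + ∫ y, |y| ∂μ) * w +
        (2 * w)⁻¹ * ∫ t in (-(T + w))..(T + w), ‖empCharFun xs t - charFun μ t‖)
          ∂(Measure.pi fun _ => μ) :=
        integral_mono (integrable_supDeviation μ T n)
          (hlipschitz.add (haverage.const_mul _)) (supDeviation_le hμ hT hw)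
    _ = (∫ y, |y| ∂μ + ∫ y, |y| ∂μ) * w + (2 * w)⁻¹ * ∫ xs : Fin n → ℝ,
        (∫ t in (-(T + w))..(T + w), ‖empCharFun xs t - charFun μ t‖) ∂(Measure.pi fun _ => μ) := by
        rw [integral_add hlipschitz (haverage.const_mul _),
          integral_mul_const, integral_const_mul, integral_add hmean (integrable_const _),
          integral_sampleMean hμ.abs hn, integral_const, probReal_univ, one_smul]
    _ ≤ (∫ y, |y| ∂μ + ∫ y, |y| ∂μ) * w + (2 * w)⁻¹ * (2 * (T + w) / √n) := by
        gcongr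
        exact integral_intervalIntegral_norm_empCharFun_sub_charFun_le μ hn hS
    _ = 2 * (∫ y, |y| ∂μ) * w + (T + w) / (w * √n) := by
        have : 0 < √(n : ℝ) := Real.sqrt_pos.2 (by positivity)
        field_simp
        ring

/-- The window `w = n^{-1/4}` balances the two terms of `integral_supDeviation_le`. -/
theorem integral_supDeviation_le_rpow (hμ : Integrable (fun y : ℝ => y) μ) (hT : 0 ≤ T)
    (hn : n ≠ 0) :
    ∫ xs : Fin n → ℝ, supDeviation μ T xs ∂(Measure.pi fun _ => μ) ≤
      (2 * ∫ y, |y| ∂μ + T + 1) * (n : ℝ) ^ (-(1 / 4) : ℝ) := by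
  have hn0 : (0 : ℝ) < n := by positivity
  set w := (n : ℝ) ^ (-(1 / 4) : ℝ) with hwdef
  have hw : 0 < w := by positivity
  have hw1 : w ≤ 1 := Real.rpow_le_one_of_one_le_of_nonpos
    (Nat.one_le_cast.2 (Nat.one_le_iff_ne_zero.2 hn)) (by norm_num)
  have hsqrt : √(n : ℝ) = (w ^ 2)⁻¹ := by
    rw [hwdef, ← Real.rpow_mul_natCast hn0.le, ← Real.rpow_neg hn0.le, Real.sqrt_eq_rpow]
    norm_num
  calc _ ≤ 2 * (∫ y, |y| ∂μ) * w + (T + w) / (w * √n) := integral_supDeviation_le hμ hT hw hn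
    _ = 2 * (∫ y, |y| ∂μ) * w + (T + w) * w := by
        rw [hsqrt]
        field_simp
    _ ≤ (2 * ∫ y, |y| ∂μ + T + 1) * w := by nlinarith

end SupDeviation

section Stability

theorem isDistinguishedLog_mul_charFun (lam : ℝ) (F : Measure ℝ) [IsProbabilityMeasure F]
    (s : Set ℝ) :
    IsDistinguishedLog (fun t => Complex.exp (lam * charFun F t)) (fun t => lam * charFun F t)
      s := by
  refine ⟨(continuous_charFun.const_mul _).continuousOn, fun _ _ => rfl, ?_⟩
  simp only [charFun_zero, probReal_univ, Complex.ofReal_one, mul_one]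
  rw [← Complex.ofReal_exp, ← Complex.ofReal_log (Real.exp_pos _).le, Real.log_exp]

variable {lam : ℝ≥0} {h : ℝ} {n : ℕ}

theorem plugInRatio_zero (lam : ℝ) (hn : n ≠ 0) (hh : 0 < h) (xs : Fin n → ℝ) :
    plugInRatio lam h xs 0 = Complex.exp lam := by
  have h0 : (0 : ℝ) ∈ Set.Icc (-(1 / h)) (1 / h) := by simp [hh.le]
  rw [plugInRatio_eq_div hh h0]
  simp [empCharFun, hn, Complex.exp_neg]

theorem exp_neg_le_norm_exp_mul_charFun (lam : ℝ≥0) (F : Measure ℝ) [IsProbabilityMeasure F]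
    (t : ℝ) : Real.exp (-lam) ≤ ‖Complex.exp ((lam : ℝ) * charFun F t)‖ := by
  rw [Complex.norm_exp, Real.exp_le_exp, Complex.re_ofReal_mul]
  have hre := (abs_le.1 ((Complex.abs_re_le_norm _).trans (norm_charFun_le_one (μ := F) t))).1
  nlinarith [lam.coe_nonneg]

variable (lam) in
theorem norm_plugInRatio_sub_exp_mul_charFun_le (F : Measure ℝ) [IsProbabilityMeasure F]
    (hh : 0 < h) (xs : Fin n → ℝ) {t : ℝ} (ht : t ∈ Set.Icc (-(1 / h)) (1 / h)) :
    ‖plugInRatio lam h xs t - Complex.exp ((lam : ℝ) * charFun F t)‖ ≤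
      Real.exp (2 * lam + (1 / h) ^ 2 / 2) * supDeviation (observationLaw lam F) (1 / h) xs *
        ‖Complex.exp ((lam : ℝ) * charFun F t)‖ := by
  set Δ := supDeviation (observationLaw lam F) (1 / h) xs
  have hΔ : 0 ≤ Δ := supDeviation_nonneg _ _ xs
  set D := Complex.exp (-((lam : ℝ) : ℂ)) * Complex.exp (-(t : ℂ) ^ 2 / 2) with hD
  have hD0 : D ≠ 0 := mul_ne_zero (Complex.exp_ne_zero _) (Complex.exp_ne_zero _)
  have hDnorm : ‖D‖ = Real.exp (-(lam + t ^ 2 / 2)) := by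
    rw [hD, ← Complex.exp_add, show -((lam : ℝ) : ℂ) + -(t : ℂ) ^ 2 / 2 =
      ((-(lam + t ^ 2 / 2) : ℝ) : ℂ) by push_cast; ring, Complex.norm_exp_ofReal]
  have htsq : t ^ 2 ≤ (1 / h) ^ 2 := sq_le_sq' ht.1 ht.2
  have hdiff : plugInRatio lam h xs t - Complex.exp ((lam : ℝ) * charFun F t) =
      (empCharFun xs t - charFun (observationLaw lam F) t) / D := by
    rw [plugInRatio_eq_div hh ht, charFun_observationLaw, ← hD, sub_div,
      mul_div_cancel_right₀ _ hD0]
  calc _ = ‖empCharFun xs t - charFun (observationLaw lam F) t‖ * Real.exp (lam + t ^ 2 / 2) := by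
        rw [hdiff, norm_div, hDnorm, Real.exp_neg, div_inv_eq_mul]
    _ ≤ Δ * Real.exp (lam + (1 / h) ^ 2 / 2) := by
        gcongr
        exact norm_empCharFun_sub_charFun_le_supDeviation _ xs ht
    _ = Real.exp (2 * lam + (1 / h) ^ 2 / 2) * Δ * Real.exp (-lam) := by
        rw [mul_comm, mul_right_comm, ← Real.exp_add]
        ring_nf
    _ ≤ _ := by
        gcongr
        exact exp_neg_le_norm_exp_mul_charFun lam F t

theorem abs_fnh_sub_re_truncatedInversion_le (hlam : 0 < lam) (F : Measure ℝ)
    [IsProbabilityMeasure F] (hh : 0 < h) (hn : n ≠ 0) {xs : Fin n → ℝ}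
    (hxs : Real.exp (2 * lam + (1 / h) ^ 2 / 2) *
      supDeviation (observationLaw lam F) (1 / h) xs ≤ 1 / 2) (x : ℝ) :
    |fnh lam h xs x - (truncatedInversion (1 / h) (charFun F) x).re| ≤
      3 * (1 / h) / (2 * Real.pi * lam) * (Real.exp (2 * lam + (1 / h) ^ 2 / 2) *
        supDeviation (observationLaw lam F) (1 / h) xs) := by
  have hlam' : ((lam : ℝ) : ℂ) ≠ 0 := by exact_mod_cast hlam.ne'
  have hT : 0 ≤ 1 / h := by positivity
  have hlog := (isDistinguishedLog_mul_charFun lam F _).norm_truncatedInversion_sub_le hT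
    (continuousOn_plugInRatio lam hh xs) (by simp [plugInRatio_zero lam hn hh]) hxs
    (fun t ht => norm_plugInRatio_sub_exp_mul_charFun_le lam F hh xs ht) x
  rw [truncatedInversion_const_mul] at hlog
  rw [fnh, fnhComplex_eq_inv_mul_truncatedInversion, ← Complex.sub_re]
  refine (Complex.abs_re_le_norm _).trans ?_
  rw [← inv_mul_cancel_left₀ hlam' (truncatedInversion (1 / h) (charFun F) x),
    ← mul_sub, norm_mul, norm_inv, Complex.norm_real,
    Real.norm_of_nonneg lam.coe_nonneg]
  refine (mul_le_mul_of_nonneg_left hlog (by positivity)).trans_eq ?_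
  field_simp

theorem abs_fHat_sub_re_truncatedInversion_le (hlam : 0 < lam) (F : Measure ℝ)
    [IsProbabilityMeasure F] (hh : 0 < h) (hn : n ≠ 0) {M x : ℝ}
    (hM : |(truncatedInversion (1 / h) (charFun F) x).re| ≤ M) (xs : Fin n → ℝ) :
    |fHat lam h M xs x - (truncatedInversion (1 / h) (charFun F) x).re| ≤
      (3 * (1 / h) / (2 * Real.pi * lam) + 4 * M) * Real.exp (2 * lam + (1 / h) ^ 2 / 2) *
        supDeviation (observationLaw lam F) (1 / h) xs := by
  set D := (truncatedInversion (1 / h) (charFun F) x).re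
  set Δ := supDeviation (observationLaw lam F) (1 / h) xs
  have hM0 : 0 ≤ M := (abs_nonneg D).trans hM
  have : (0 : ℝ) < lam := hlam
  have hΔ : 0 ≤ Real.exp (2 * lam + (1 / h) ^ 2 / 2) * Δ :=
    mul_nonneg (Real.exp_pos _).le (supDeviation_nonneg _ _ xs)
  rw [mul_assoc, add_mul]
  rcases le_or_gt (Real.exp (2 * lam + (1 / h) ^ 2 / 2) * Δ) (1 / 2) with hsmall | hlarge
  · exact ((abs_fHat_sub_le lam h hM xs x).trans
      (abs_fnh_sub_re_truncatedInversion_le hlam F hh hn hsmall x)).trans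
      (le_add_of_nonneg_right (mul_nonneg (by positivity) hΔ))
  · have hfHat : |fHat lam h M xs x| ≤ M :=
      (abs_fHat_le (lam : ℝ) h M xs x).trans_eq (abs_of_nonneg hM0)
    calc |fHat lam h M xs x - D| ≤ 2 * M := by linarith [abs_sub (fHat lam h M xs x) D]
      _ ≤ 4 * M * (Real.exp (2 * lam + (1 / h) ^ 2 / 2) * Δ) := by nlinarith
      _ ≤ _ := le_add_of_nonneg_left (mul_nonneg (by positivity) hΔ)

theorem integrable_fHat_pi (lam : ℝ) (hh : 0 < h) (M : ℝ) (n : ℕ) (x : ℝ)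
    (Q : Measure (Fin n → ℝ)) [IsFiniteMeasure Q] :
    Integrable (fun xs => fHat lam h M xs x) Q :=
  Integrable.of_bound (measurable_fHat lam hh M n x).aestronglyMeasurable |M|
    (ae_of_all _ fun xs => abs_fHat_le lam h M xs x)

theorem abs_integral_fHat_sub_re_truncatedInversion_le (hlam : 0 < lam) {F : Measure ℝ}
    [IsProbabilityMeasure F] (hF : Integrable (fun y : ℝ => y) F) (hh : 0 < h) (hn : n ≠ 0)
    {M x : ℝ} (hM : |(truncatedInversion (1 / h) (charFun F) x).re| ≤ M) :
    |∫ xs : Fin n → ℝ, fHat lam h M xs x ∂(Measure.pi fun _ => observationLaw lam F) -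
        (truncatedInversion (1 / h) (charFun F) x).re| ≤
      (3 * (1 / h) / (2 * Real.pi * lam) + 4 * M) * Real.exp (2 * lam + (1 / h) ^ 2 / 2) *
        ((2 * ∫ y, |y| ∂(observationLaw lam F) + 1 / h + 1) * (n : ℝ) ^ (-(1 / 4) : ℝ)) := by
  set D := (truncatedInversion (1 / h) (charFun F) x).re
  have hM0 : 0 ≤ M := (abs_nonneg D).trans hM
  have : (0 : ℝ) < lam := hlam
  set Q : Measure (Fin n → ℝ) := Measure.pi fun _ => observationLaw lam F
  have hcentred : ∫ xs, fHat lam h M xs x ∂Q - D = ∫ xs, (fHat lam h M xs x - D) ∂Q := by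
    rw [integral_sub (integrable_fHat_pi _ hh _ _ _ _) (integrable_const _), integral_const,
      probReal_univ, one_smul]
  rw [hcentred, ← Real.norm_eq_abs]
  refine (norm_integral_le_of_norm_le ((integrable_supDeviation _ _ n).const_mul _)
    (ae_of_all _ (abs_fHat_sub_re_truncatedInversion_le hlam F hh hn hM))).trans ?_
  rw [integral_const_mul]
  gcongr
  exact integral_supDeviation_le_rpow (integrable_id_observationLaw lam hF) (by positivity) hn

end Stability

section FourierInversion

variable {F : Measure ℝ} {f : ℝ → ℝ}

theorem integrable_of_withDensity_ofReal [IsFiniteMeasure F] (hf_meas : Measurable f)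
    (hf_nonneg : ∀ y, 0 ≤ f y) (hF : F = volume.withDensity fun y => ENNReal.ofReal (f y)) :
    Integrable f := by
  refine ⟨hf_meas.aestronglyMeasurable, ?_⟩
  rw [hasFiniteIntegral_iff_ofReal (ae_of_all _ hf_nonneg), ← setLIntegral_univ,
    ← withDensity_apply _ MeasurableSet.univ, ← hF]
  exact measure_lt_top F _

theorem integrable_id_of_integrable_abs_rpow_mul [IsFiniteMeasure F] (hf_meas : Measurable f)
    (hf_nonneg : ∀ y, 0 ≤ f y) (hF : F = volume.withDensity fun y => ENNReal.ofReal (f y))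
    {ρ : ℝ} (hρ : 1 ≤ ρ) (hmom : Integrable fun y : ℝ => |y| ^ ρ * f y) :
    Integrable (fun y : ℝ => y) F := by
  have habs : ∀ y : ℝ, |y| ≤ 1 + |y| ^ ρ := fun y => by
    rcases le_total |y| 1 with hy | hy
    · linarith [Real.rpow_nonneg (abs_nonneg y) ρ]
    · linarith [Real.self_le_rpow_of_one_le hy hρ]
  rw [hF, integrable_withDensity_iff_integrable_smul' (by fun_prop)
    (ae_of_all _ fun _ => ENNReal.ofReal_lt_top)]
  refine ((integrable_of_withDensity_ofReal hf_meas hf_nonneg hF).add hmom).mono'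
    (by fun_prop) (ae_of_all _ fun y => ?_)
  rw [ENNReal.toReal_ofReal (hf_nonneg y), norm_smul, Real.norm_of_nonneg (hf_nonneg y),
    Real.norm_eq_abs, Pi.add_apply]
  nlinarith [habs y, hf_nonneg y]

theorem charFun_eq_integral_mul_density (hf_meas : Measurable f) (hf_nonneg : ∀ y, 0 ≤ f y)
    (hF : F = volume.withDensity fun y => ENNReal.ofReal (f y)) (t : ℝ) :
    charFun F t = ∫ y : ℝ, Complex.exp (t * y * Complex.I) * (f y : ℂ) := by
  rw [charFun_apply_real, hF, integral_withDensity_eq_integral_toReal_smul (by fun_prop)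
    (ae_of_all _ fun _ => ENNReal.ofReal_lt_top)]
  congr 1 with y
  rw [ENNReal.toReal_ofReal (hf_nonneg y), Complex.real_smul, mul_comm]

theorem density_eq_integral_charFun [IsFiniteMeasure F] (hf_meas : Measurable f)
    (hf_nonneg : ∀ y, 0 ≤ f y) (hF : F = volume.withDensity fun y => ENNReal.ofReal (f y))
    (hφ : Integrable (charFun F)) {x : ℝ} (hx : ContinuousAt f x) :
    (f x : ℂ) = 1 / (2 * Real.pi) * ∫ t : ℝ, Complex.exp (-Complex.I * t * x) * charFun F t := by
  have hfourier : FourierTransform.fourier (fun y => (f y : ℂ)) =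
      fun w : ℝ => charFun F (-(2 * Real.pi) * w) := by
    ext w
    rw [Real.fourier_eq', charFun_eq_integral_mul_density hf_meas hf_nonneg hF]
    congr 1 with y
    rw [smul_eq_mul]
    congr 2
    push_cast [RCLike.inner_apply, conj_trivial]
    ring
  have hint : Integrable (FourierTransform.fourier fun y => (f y : ℂ)) := by
    rw [hfourier]
    exact hφ.comp_mul_left' (neg_ne_zero.2 (by positivity))
  have hinversion : FourierTransformInv.fourierInv
      (FourierTransform.fourier fun y => (f y : ℂ)) x = f x :=
    (integrable_of_withDensity_ofReal hf_meas hf_nonneg hF).ofReal.fourierInv_fourier_eq hint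
      (Complex.continuous_ofReal.continuousAt.comp hx)
  have hscale : |(-(2 * Real.pi))⁻¹| = 1 / (2 * Real.pi) := by
    rw [abs_inv, abs_neg, abs_of_pos (by positivity), one_div]
  have hsubst := Measure.integral_comp_mul_left
    (fun t : ℝ => Complex.exp (-Complex.I * t * x) * charFun F t) (-(2 * Real.pi))
  rw [hscale, Complex.real_smul] at hsubst
  push_cast at hsubst
  rw [← hinversion, hfourier, Real.fourierInv_eq', ← hsubst]
  congr 1 with w
  rw [smul_eq_mul]
  congr 2
  push_cast [RCLike.inner_apply, conj_trivial]
  ring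

theorem integral_Iic_neg_norm_charFun (F : Measure ℝ) (T : ℝ) :
    ∫ t in Set.Iic (-T), ‖charFun F t‖ = ∫ t in Set.Ioi T, ‖charFun F t‖ := by
  simp only [← integral_comp_neg_Ioi, charFun_neg, RCLike.norm_conj]

theorem norm_intervalIntegral_sub_integral_le {E : Type*} [NormedAddCommGroup E] [NormedSpace ℝ E]
    {G : ℝ → E} (hG : Integrable G) (a b : ℝ) :
    ‖(∫ t in a..b, G t) - ∫ t, G t‖ ≤ (∫ t in Set.Iic a, ‖G t‖) + ∫ t in Set.Ioi b, ‖G t‖ := by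
  have hsplit : (∫ t in a..b, G t) - ∫ t, G t =
      -((∫ t in Set.Iic a, G t) + ∫ t in Set.Ioi b, G t) := by
    rw [← intervalIntegral.integral_Iic_add_Ioi (b := b) hG.integrableOn hG.integrableOn,
      ← intervalIntegral.integral_Iic_sub_Iic hG.integrableOn hG.integrableOn]
    abel
  rw [hsplit, norm_neg]
  exact norm_add_le_of_le (norm_integral_le_integral_norm _) (norm_integral_le_integral_norm _)

theorem norm_truncatedInversion_sub_density_le [IsFiniteMeasure F] (hf_meas : Measurable f)
    (hf_nonneg : ∀ y, 0 ≤ f y) (hF : F = volume.withDensity fun y => ENNReal.ofReal (f y))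
    (hφ : Integrable (charFun F)) {x : ℝ} (hx : ContinuousAt f x) (T : ℝ) :
    ‖truncatedInversion T (charFun F) x - f x‖ ≤ ∫ t in Set.Ioi T, ‖charFun F t‖ := by
  have hnorm : ∀ t : ℝ, ‖Complex.exp (-Complex.I * t * x) * charFun F t‖ = ‖charFun F t‖ :=
    fun t => by rw [norm_mul, norm_exp_neg_I_mul_mul, one_mul]
  have hint : Integrable fun t : ℝ => Complex.exp (-Complex.I * t * x) * charFun F t :=
    hφ.mono ((Continuous.aestronglyMeasurable (by fun_prop)).mul hφ.1)
      (ae_of_all _ fun t => (hnorm t).le)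
  have htails := norm_intervalIntegral_sub_integral_le hint (-T) T
  simp only [hnorm, integral_Iic_neg_norm_charFun] at htails
  have hconst : ‖(1 / (2 * Real.pi) : ℂ)‖ = 1 / (2 * Real.pi) := by
    simp [abs_of_pos Real.pi_pos]
  set J := ∫ t in Set.Ioi T, ‖charFun F t‖
  have hJ : 0 ≤ J := integral_nonneg fun _ => norm_nonneg _
  rw [density_eq_integral_charFun hf_meas hf_nonneg hF hφ hx, truncatedInversion, ← mul_sub,
    norm_mul, hconst]
  calc _ ≤ 1 / (2 * Real.pi) * (J + J) := by gcongr
    _ = J / Real.pi := by field_simp; ring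
    _ ≤ J := div_le_self hJ (by linarith [Real.pi_gt_three])

end FourierInversion

section Tails

variable {E : Type*} [NormedAddCommGroup E] {φ : ℝ → E} {g r : ℝ → ℝ} {B c : ℝ}

theorem exists_forall_norm_le_mul_of_isBigO (hB : ∀ t, ‖φ t‖ ≤ B) (hO : φ =O[atTop] g)
    (hg : AntitoneOn g (Set.Ioi 0)) (hg_pos : ∀ t, 0 < t → 0 < g t) :
    ∃ K, 0 ≤ K ∧ ∀ t, 0 < t → ‖φ t‖ ≤ K * g t := by
  obtain ⟨c, hc⟩ := hO.bound
  obtain ⟨S, hS⟩ := eventually_atTop.1 hc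
  have hS₀ : 0 < max S 1 := lt_max_of_lt_right one_pos
  have hB0 : 0 ≤ B := (norm_nonneg _).trans (hB 0)
  refine ⟨max c (B / g (max S 1)), le_max_of_le_right (div_nonneg hB0 (hg_pos _ hS₀).le),
    fun t ht => ?_⟩
  have hgt := hg_pos t ht
  rcases le_total (max S 1) t with hSt | htS
  · refine (hS t ((le_max_left _ _).trans hSt)).trans ?_
    rw [Real.norm_of_nonneg hgt.le]
    gcongr
    exact le_max_left _ _
  · calc ‖φ t‖ ≤ B := hB t
      _ = B / g (max S 1) * g (max S 1) := (div_mul_cancel₀ _ (hg_pos _ hS₀).ne').symm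
      _ ≤ max c (B / g (max S 1)) * g t :=
        mul_le_mul (le_max_right _ _) (hg ht hS₀ htS) (hg_pos _ hS₀).le
          (le_max_of_le_right (div_nonneg hB0 (hg_pos _ hS₀).le))

theorem exists_forall_integral_Ioi_norm_le (hφ : Integrable φ) (hB : ∀ t, ‖φ t‖ ≤ B)
    (hO : φ =O[atTop] g) (hg : AntitoneOn g (Set.Ioi 0)) (hg_pos : ∀ t, 0 < t → 0 < g t)
    (hg_int : ∀ T, 0 < T → IntegrableOn g (Set.Ioi T))
    (hgr : ∀ T, 0 < T → ∫ t in Set.Ioi T, g t ≤ c * r T) :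
    ∃ K, ∀ T, 0 < T → ∫ t in Set.Ioi T, ‖φ t‖ ≤ K * r T := by
  obtain ⟨K, hK, hφg⟩ := exists_forall_norm_le_mul_of_isBigO hB hO hg hg_pos
  refine ⟨K * c, fun T hT => ?_⟩
  calc ∫ t in Set.Ioi T, ‖φ t‖ ≤ ∫ t in Set.Ioi T, K * g t :=
        setIntegral_mono_on hφ.norm.integrableOn ((hg_int T hT).const_mul K) measurableSet_Ioi
          fun t ht => hφg t (hT.trans ht)
    _ = K * ∫ t in Set.Ioi T, g t := integral_const_mul _ _
    _ ≤ K * (c * r T) := by gcongr; exact hgr T hT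
    _ = K * c * r T := (mul_assoc _ _ _).symm

theorem exists_forall_integral_Ioi_norm_le_of_isBigO_rpow {γ : ℝ} (hγ : 1 < γ)
    (hφ : Integrable φ) (hB : ∀ t, ‖φ t‖ ≤ B) (hO : φ =O[atTop] fun t : ℝ => |t| ^ (-γ)) :
    ∃ K, ∀ T, 0 < T → ∫ t in Set.Ioi T, ‖φ t‖ ≤ K * T ^ (1 - γ) := by
  refine exists_forall_integral_Ioi_norm_le (g := fun t => t ^ (-γ)) (c := 1 / (γ - 1)) hφ hB
    (hO.congr' .rfl ((eventually_ge_atTop 0).mono fun t ht => by simp only [abs_of_nonneg ht]))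
    (fun s hs t _ hst => Real.rpow_le_rpow_of_nonpos hs hst (by linarith))
    (fun t ht => Real.rpow_pos_of_pos ht _)
    (fun T hT => integrableOn_Ioi_rpow_of_lt (by linarith) hT) fun T hT => ?_
  rw [integral_Ioi_rpow_of_lt (by linarith) hT, neg_add_eq_sub, ← neg_sub γ 1, neg_div_neg_eq,
    one_div, inv_mul_eq_div]

theorem integrableOn_Ioi_exp_neg_rpow {α T : ℝ} (hα : 0 < α) (hT : 0 ≤ T) :
    IntegrableOn (fun t : ℝ => Real.exp (-t ^ α)) (Set.Ioi T) := by
  simpa only [Real.rpow_zero, one_mul] using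
    (integrableOn_rpow_mul_exp_neg_rpow (s := 0) (by norm_num) hα).mono_set
      (Set.Ioi_subset_Ioi hT)

theorem integral_Ioi_rpow_mul_exp_neg_rpow {α T : ℝ} (hα : 0 < α) (hT : 0 < T) :
    ∫ t in Set.Ioi T, t ^ (α - 1) * Real.exp (-t ^ α) = Real.exp (-T ^ α) / α := by
  have hderiv : ∀ t ∈ Set.Ici T, HasDerivAt (fun t : ℝ => -(Real.exp (-t ^ α) / α))
      (t ^ (α - 1) * Real.exp (-t ^ α)) t := fun t ht => by
    have ht0 : t ≠ 0 := (hT.trans_le ht).ne'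
    refine ((Real.hasDerivAt_rpow_const (p := α) (Or.inl ht0)).neg.exp.div_const α).neg.congr_deriv
      ?_
    rw [Pi.neg_apply]
    field_simp
  have hlim : Tendsto (fun t : ℝ => -(Real.exp (-t ^ α) / α)) atTop (nhds 0) := by
    simpa using ((Real.tendsto_exp_neg_atTop_nhds_zero.comp
      (tendsto_rpow_atTop hα)).div_const α).neg
  rw [integral_Ioi_of_hasDerivAt_of_tendsto' hderiv
    ((integrableOn_rpow_mul_exp_neg_rpow (by linarith) hα).mono_set
      (Set.Ioi_subset_Ioi hT.le)) hlim, zero_sub, neg_neg]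

theorem integral_Ioi_exp_neg_rpow_le {α T : ℝ} (hα : 1 ≤ α) (hT : 0 < T) :
    ∫ t in Set.Ioi T, Real.exp (-t ^ α) ≤ 1 / α * (T ^ (1 - α) * Real.exp (-T ^ α)) := by
  have hα0 : 0 < α := by linarith
  have hone_le : ∀ t ∈ Set.Ioi T, 1 ≤ T ^ (1 - α) * t ^ (α - 1) := fun t ht => by
    rw [← neg_sub, Real.rpow_neg hT.le, inv_mul_eq_div, one_le_div (Real.rpow_pos_of_pos hT _)]
    exact Real.rpow_le_rpow hT.le (Set.mem_Ioi.1 ht).le (by linarith)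
  calc ∫ t in Set.Ioi T, Real.exp (-t ^ α)
      ≤ ∫ t in Set.Ioi T, T ^ (1 - α) * (t ^ (α - 1) * Real.exp (-t ^ α)) := by
        refine setIntegral_mono_on (integrableOn_Ioi_exp_neg_rpow hα0 hT.le)
          (((integrableOn_rpow_mul_exp_neg_rpow (by linarith) hα0).mono_set
            (Set.Ioi_subset_Ioi hT.le)).const_mul _) measurableSet_Ioi fun t ht => ?_
        rw [← mul_assoc]
        exact le_mul_of_one_le_left (Real.exp_pos _).le (hone_le t ht)
    _ = 1 / α * (T ^ (1 - α) * Real.exp (-T ^ α)) := by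
        rw [integral_const_mul, integral_Ioi_rpow_mul_exp_neg_rpow hα0 hT]
        ring

theorem exists_forall_integral_Ioi_norm_le_of_isBigO_exp {α : ℝ} (hα : 1 ≤ α)
    (hφ : Integrable φ) (hB : ∀ t, ‖φ t‖ ≤ B)
    (hO : φ =O[atTop] fun t : ℝ => Real.exp (-|t| ^ α)) :
    ∃ K, ∀ T, 0 < T → ∫ t in Set.Ioi T, ‖φ t‖ ≤ K * (T ^ (1 - α) * Real.exp (-T ^ α)) :=
  exists_forall_integral_Ioi_norm_le (g := fun t => Real.exp (-t ^ α)) hφ hB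
    (hO.congr' .rfl ((eventually_ge_atTop 0).mono fun t ht => by simp only [abs_of_nonneg ht]))
    (fun s hs t _ hst => Real.exp_le_exp.2 <| neg_le_neg <|
      Real.rpow_le_rpow (Set.mem_Ioi.1 hs).le hst (by linarith))
    (fun t _ => Real.exp_pos _) (fun T hT => integrableOn_Ioi_exp_neg_rpow (by linarith) hT.le)
    fun T hT => integral_Ioi_exp_neg_rpow_le hα hT

end Tails

section Rates

theorem isBigO_exp_mul_sq_rpow {T : ℕ → ℝ} (hT : T =o[atTop] fun n : ℕ => √(Real.log n)) (a : ℝ)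
    {κ : ℝ} (hκ : 0 < κ) :
    (fun n => Real.exp (a * T n ^ 2)) =O[atTop] fun n : ℕ => (n : ℝ) ^ κ := by
  have hsq : (fun n => a * T n ^ 2) =o[atTop] fun n : ℕ => Real.log n :=
    ((hT.pow two_pos).const_mul_left a).congr_right
      fun n => Real.sq_sqrt (Real.log_natCast_nonneg n)
  refine IsBigO.of_bound 1 ?_
  filter_upwards [hsq.bound hκ, eventually_gt_atTop 0] with n hn hn0
  rw [one_mul, Real.norm_of_nonneg (Real.exp_pos _).le, Real.norm_of_nonneg (by positivity),
    Real.rpow_def_of_pos (by exact_mod_cast hn0), Real.exp_le_exp, mul_comm (Real.log _)]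
  rw [Real.norm_of_nonneg (Real.log_natCast_nonneg n)] at hn
  exact (Real.le_norm_self _).trans hn

theorem isBigO_rpow_neg_of_exp_neg_le {T r : ℕ → ℝ} {a c κ : ℝ}
    (hT : T =o[atTop] fun n : ℕ => √(Real.log n)) (hκ : 0 < κ)
    (hr : ∀ n, Real.exp (-(a * T n ^ 2)) ≤ c * r n) :
    (fun n : ℕ => (n : ℝ) ^ (-κ)) =O[atTop] r := by
  have hinv : (fun n : ℕ => (n : ℝ) ^ (-κ)) =O[atTop] fun n => Real.exp (-(a * T n ^ 2)) := by
    simp only [Real.exp_neg, Real.rpow_neg (Nat.cast_nonneg _)]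
    exact (isBigO_exp_mul_sq_rpow hT a hκ).inv_rev
      (Eventually.of_forall fun n h0 => absurd h0 (Real.exp_pos _).ne')
  refine hinv.trans (IsBigO.of_bound |c| (Eventually.of_forall fun n => ?_))
  rw [Real.norm_of_nonneg (Real.exp_pos _).le, Real.norm_eq_abs, ← abs_mul]
  exact (hr n).trans (le_abs_self _)

theorem exp_neg_mul_sq_le_rpow_neg {T p : ℝ} (hT : 0 < T) (hp : 0 ≤ p) :
    Real.exp (-(p * T ^ 2)) ≤ T ^ (-p) := by
  have hTexp : T ≤ Real.exp (T ^ 2) := by nlinarith [Real.add_one_le_exp (T ^ 2)]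
  rw [Real.rpow_neg hT.le, Real.exp_neg, mul_comm, Real.exp_mul]
  exact inv_anti₀ (Real.rpow_pos_of_pos hT p) (Real.rpow_le_rpow hT.le hTexp hp)

theorem one_div_rpow_one_sub {h : ℝ} (hh : 0 ≤ h) (a : ℝ) : (1 / h) ^ (1 - a) = h ^ (a - 1) := by
  rw [one_div, Real.inv_rpow hh, ← Real.rpow_neg hh, neg_sub]

theorem rpow_le_one_add_sq {T α : ℝ} (hT : 0 ≤ T) (hα : 0 ≤ α) (hα2 : α ≤ 2) :
    T ^ α ≤ 1 + T ^ 2 := by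
  rcases le_total T 1 with h | h
  · linarith [Real.rpow_le_one hT h hα, sq_nonneg T]
  · have := Real.rpow_le_rpow_of_exponent_le h hα2
    rw [Real.rpow_two] at this
    linarith

theorem exp_neg_mul_sq_le_rpow_neg_mul_exp {T p α : ℝ} (hT : 0 < T) (hp : 0 ≤ p) (hα : 0 ≤ α)
    (hα2 : α ≤ 2) :
    Real.exp (-((p + 1) * T ^ 2)) ≤ Real.exp 1 * (T ^ (-p) * Real.exp (-T ^ α)) := by
  calc Real.exp (-((p + 1) * T ^ 2))
      = Real.exp 1 * (Real.exp (-(p * T ^ 2)) * Real.exp (-(1 + T ^ 2))) := by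
        rw [← Real.exp_add, ← Real.exp_add]
        ring_nf
    _ ≤ Real.exp 1 * (T ^ (-p) * Real.exp (-T ^ α)) := by
        gcongr
        · exact exp_neg_mul_sq_le_rpow_neg hT hp
        · exact rpow_le_one_add_sq hT.le hα hα2

theorem isLittleO_rpow_rpow_atTop {a b : ℝ} (hab : a < b) :
    (fun x : ℝ => x ^ a) =o[atTop] fun x : ℝ => x ^ b := by
  have hlim : (fun x : ℝ => x ^ (-(b - a))) =o[atTop] fun _ => (1 : ℝ) :=
    (isLittleO_one_iff ℝ).2 (tendsto_rpow_neg_atTop (sub_pos.2 hab))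
  refine ((isBigO_refl (fun x : ℝ => x ^ b) atTop).mul_isLittleO hlim).congr' ?_
    (.of_forall fun x => mul_one _)
  filter_upwards [eventually_gt_atTop 0] with x hx
  rw [← Real.rpow_add hx, neg_sub, add_sub_cancel]

theorem tendsto_log_natCast_atTop : Tendsto (fun n : ℕ => Real.log n) atTop atTop :=
  Real.tendsto_log_atTop.comp tendsto_natCast_atTop_atTop

theorem isLittleO_one_div_of_isEquivalent_log_rpow {h : ℕ → ℝ} {β : ℝ} (hβ : β < 1 / 2)
    (hh : h ~[atTop] fun n : ℕ => Real.log n ^ (-β)) :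
    (fun n => 1 / h n) =o[atTop] fun n : ℕ => √(Real.log n) := by
  have hinv : (fun n => 1 / h n) =O[atTop] fun n : ℕ => Real.log n ^ β := by
    simpa only [one_div, Pi.inv_def, Real.rpow_neg (Real.log_natCast_nonneg _), inv_inv]
      using hh.inv.isBigO
  simp only [Real.sqrt_eq_rpow]
  exact hinv.trans_isLittleO ((isLittleO_rpow_rpow_atTop hβ).comp_tendsto tendsto_log_natCast_atTop)

/-- The three growing factors of the stochastic error are each `O(n^{1/24})`, which leaves
`n^{-1/8}` of the factor `n^{-1/4}`. -/
theorem isBigO_mul_exp_mul_rpow {T M : ℕ → ℝ} (hT : T =o[atTop] fun n : ℕ => √(Real.log n))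
    (hM : M =O[atTop] fun n : ℕ => Real.log n) (a b c : ℝ) :
    (fun n : ℕ => (a * T n + 4 * M n) * Real.exp (b + T n ^ 2 / 2) *
      ((c + T n + 1) * (n : ℝ) ^ (-(1 / 4) : ℝ))) =O[atTop]
      fun n : ℕ => (n : ℝ) ^ (-(1 / 8) : ℝ) := by
  have hlog (s : ℝ) : (fun n : ℕ => Real.log n ^ s) =O[atTop] fun n : ℕ => (n : ℝ) ^ (1 / 24 : ℝ) :=
    ((isLittleO_log_rpow_rpow_atTop s (by norm_num)).comp_tendsto
      tendsto_natCast_atTop_atTop).isBigO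
  have hTO : T =O[atTop] fun n : ℕ => (n : ℝ) ^ (1 / 24 : ℝ) := by
    simp only [Real.sqrt_eq_rpow] at hT
    exact hT.isBigO.trans (hlog _)
  have hMO : M =O[atTop] fun n : ℕ => (n : ℝ) ^ (1 / 24 : ℝ) :=
    hM.trans (by simpa only [Real.rpow_one] using hlog 1)
  have hconst (d : ℝ) : (fun _ : ℕ => d) =O[atTop] fun n : ℕ => (n : ℝ) ^ (1 / 24 : ℝ) :=
    (isBigO_const_const d one_ne_zero _).trans (by simpa only [Real.rpow_zero] using hlog 0)
  have hexp : (fun n => Real.exp (b + T n ^ 2 / 2)) =O[atTop]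
      fun n : ℕ => (n : ℝ) ^ (1 / 24 : ℝ) :=
    ((isBigO_exp_mul_sq_rpow hT (1 / 2) (by norm_num)).const_mul_left (Real.exp b)).congr_left
      fun n => by rw [← Real.exp_add, one_div_mul_eq_div]
  refine ((((hTO.const_mul_left a).add (hMO.const_mul_left 4)).mul hexp).mul
    ((((hconst c).add hTO).add (hconst 1)).mul (isBigO_refl _ _))).trans_eventuallyEq ?_
  filter_upwards [eventually_gt_atTop 0] with n hn
  have hn0 : (0 : ℝ) < n := by exact_mod_cast hn
  rw [← Real.rpow_add hn0, ← Real.rpow_add hn0, ← Real.rpow_add hn0]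
  norm_num

end Rates

section Bias

variable {lam : ℝ≥0} {F : Measure ℝ} [IsProbabilityMeasure F] {f : ℝ → ℝ} {x : ℝ}

theorem abs_integral_fHat_sub_density_le (hlam : 0 < lam) (hf_meas : Measurable f)
    (hf_nonneg : ∀ y, 0 ≤ f y) (hF : F = volume.withDensity fun y => ENNReal.ofReal (f y))
    (hmean : Integrable (fun y : ℝ => y) F) (hφ : Integrable (charFun F))
    (hx : ContinuousAt f x) {h M : ℝ} {n : ℕ} (hh : 0 < h) (hn : n ≠ 0)
    (hM : |f x| + ∫ t, ‖charFun F t‖ ≤ M) :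
    |∫ xs : Fin n → ℝ, fHat lam h M xs x ∂(Measure.pi fun _ => observationLaw lam F) - f x| ≤
      (3 * (1 / h) / (2 * Real.pi * lam) + 4 * M) * Real.exp (2 * lam + (1 / h) ^ 2 / 2) *
        ((2 * ∫ y, |y| ∂(observationLaw lam F) + 1 / h + 1) * (n : ℝ) ^ (-(1 / 4) : ℝ)) +
      ∫ t in Set.Ioi (1 / h), ‖charFun F t‖ := by
  set D := (truncatedInversion (1 / h) (charFun F) x).re with hD
  have hbias : |D - f x| ≤ ∫ t in Set.Ioi (1 / h), ‖charFun F t‖ := by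
    rw [hD, ← Complex.ofReal_re (f x), ← Complex.sub_re]
    exact (Complex.abs_re_le_norm _).trans
      (norm_truncatedInversion_sub_density_le hf_meas hf_nonneg hF hφ hx _)
  have htail : ∫ t in Set.Ioi (1 / h), ‖charFun F t‖ ≤ ∫ t, ‖charFun F t‖ :=
    setIntegral_le_integral hφ.norm (ae_of_all _ fun _ => norm_nonneg _)
  have hDM : |D| ≤ M := by linarith [abs_sub_abs_le_abs_sub D (f x)]
  exact (abs_sub_le _ D _).trans
    (add_le_add (abs_integral_fHat_sub_re_truncatedInversion_le hlam hmean hh hn hDM) hbias)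

theorem isBigO_integral_fHat_sub_density (hlam : 0 < lam) (hf_meas : Measurable f)
    (hf_nonneg : ∀ y, 0 ≤ f y) (hF : F = volume.withDensity fun y => ENNReal.ofReal (f y))
    (hmean : Integrable (fun y : ℝ => y) F) (hφ : Integrable (charFun F))
    (hx : ContinuousAt f x) {h M : ℕ → ℝ} (h_pos : ∀ n, 0 < h n)
    (hh : (fun n => 1 / h n) =o[atTop] fun n : ℕ => √(Real.log n))
    (hM : Tendsto M atTop atTop) (hMO : M =O[atTop] fun n : ℕ => Real.log n) {r : ℝ → ℝ}
    {K a c : ℝ} (htail : ∀ T, 0 < T → ∫ t in Set.Ioi T, ‖charFun F t‖ ≤ K * r T)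
    (hr : ∀ T, 0 < T → Real.exp (-(a * T ^ 2)) ≤ c * r T) :
    (fun n : ℕ => ∫ xs : Fin n → ℝ, fHat lam (h n) (M n) xs x
      ∂(Measure.pi fun _ => observationLaw lam F) - f x) =O[atTop] fun n => r (1 / h n) := by
  have hT : ∀ n, 0 < 1 / h n := fun n => one_div_pos.2 (h_pos n)
  have hstochastic := (isBigO_mul_exp_mul_rpow hh hMO (3 / (2 * Real.pi * lam)) (2 * lam)
    (2 * ∫ y, |y| ∂(observationLaw lam F))).trans
      (isBigO_rpow_neg_of_exp_neg_le hh (by norm_num) fun n => hr _ (hT n))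
  have hbias : (fun n => ∫ t in Set.Ioi (1 / h n), ‖charFun F t‖) =O[atTop]
      fun n => r (1 / h n) :=
    IsBigO.of_bound |K| <| Eventually.of_forall fun n => by
      rw [Real.norm_of_nonneg (integral_nonneg fun _ => norm_nonneg _), Real.norm_eq_abs, ← abs_mul]
      exact (htail _ (hT n)).trans (le_abs_self _)
  refine IsBigO.trans (IsBigO.of_norm_eventuallyLE ?_) (hstochastic.add hbias)
  filter_upwards [hM.eventually_ge_atTop (|f x| + ∫ t, ‖charFun F t‖), eventually_ne_atTop 0]
    with n hMn hn
  rw [Real.norm_eq_abs, div_mul_eq_mul_div]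
  exact abs_integral_fHat_sub_density_le hlam hf_meas hf_nonneg hF hmean hφ hx (h_pos n) hn hMn

end Bias

section Sample

variable {Ω : Type*} [MeasurableSpace Ω] {P : Measure Ω}

theorem hasLaw_sample {Q : Measure ℝ} [SigmaFinite Q] {X : ℕ → Ω → ℝ}
    (hX_law : ∀ i, HasLaw (X i) Q P) (hX : iIndepFun X P) (n : ℕ) :
    HasLaw (fun ω (j : Fin n) => X j ω) (Measure.pi fun _ => Q) P :=
  (hX.precomp Fin.val_injective).hasLaw_pi fun j => hX_law j

theorem integrable_fHat_comp [IsFiniteMeasure P] {n : ℕ} {S : Ω → Fin n → ℝ}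
    (hS : AEMeasurable S P) (lam : ℝ) {h : ℝ} (hh : 0 < h) (M x : ℝ) :
    Integrable (fun ω => fHat lam h M (S ω) x) P :=
  (integrable_fHat_pi lam hh M n x (P.map S)).comp_aemeasurable hS

theorem integral_fHat_comp {n : ℕ} {S : Ω → Fin n → ℝ} {μ : Measure (Fin n → ℝ)}
    (hS : HasLaw S μ P) (lam : ℝ) {h : ℝ} (hh : 0 < h) (M x : ℝ) :
    ∫ ω, fHat lam h M (S ω) x ∂P = ∫ xs, fHat lam h M xs x ∂μ :=
  hS.integral_comp (measurable_fHat lam hh M n x).aestronglyMeasurable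

end Sample

end Decompounding

theorem mainTheorem3_general {Ω : Type*} [MeasurableSpace Ω] (P : Measure Ω)
    (lam : ℝ≥0) (hlam : 0 < lam)
    (F : Measure ℝ) [IsProbabilityMeasure F] (f : ℝ → ℝ) (hf_meas : Measurable f)
    (hf_nonneg : ∀ y, 0 ≤ f y) (hF : F = volume.withDensity fun y => ENNReal.ofReal (f y))
    (hmean : Integrable (fun y : ℝ => y) F)
    (X : ℕ → Ω → ℝ) (hX_law : ∀ i, HasLaw (X i) (Decompounding.observationLaw lam F) P)
    (hX : iIndepFun X P) (hφ : Integrable (charFun F))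
    (h : ℕ → ℝ) (h_pos : ∀ n, 0 < h n)
    (hh : (fun n => 1 / h n) =o[atTop] fun n : ℕ => √(Real.log n))
    (M : ℕ → ℝ) (hM : Tendsto M atTop atTop) (hMO : M =O[atTop] fun n : ℕ => Real.log n)
    (x : ℝ) (hx : ContinuousAt f x) :
    (∀ n, Integrable (fun ω => Decompounding.fHat lam (h n) (M n) (fun j : Fin n => X j ω) x) P) ∧
    (∀ α : ℝ, 1 ≤ α → α ≤ 2 →
      charFun F =O[atTop] (fun t : ℝ => Real.exp (-|t| ^ α)) →
      (fun n : ℕ =>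
          (∫ ω, Decompounding.fHat lam (h n) (M n) (fun j : Fin n => X j ω) x ∂P) - f x)
        =O[atTop] fun n : ℕ => h n ^ (α - 1) * Real.exp (-(1 / h n ^ α))) ∧
    (∀ γ : ℝ, 1 < γ →
      charFun F =O[atTop] (fun t : ℝ => |t| ^ (-γ)) →
      (fun n : ℕ =>
          (∫ ω, Decompounding.fHat lam (h n) (M n) (fun j : Fin n => X j ω) x ∂P) - f x)
        =O[atTop] fun n : ℕ => h n ^ (γ - 1)) := by
  have := hX.isProbabilityMeasure
  have hsample := Decompounding.hasLaw_sample hX_law hX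
  have hintegral := fun n =>
    Decompounding.integral_fHat_comp (hsample n) lam (h_pos n) (M n) x
  refine ⟨fun n => Decompounding.integrable_fHat_comp (hsample n).aemeasurable lam (h_pos n) _ x,
    fun α hα hα2 hO => ?_, fun γ hγ hO => ?_⟩ <;>
    simp only [hintegral]
  · obtain ⟨K, hK⟩ := Decompounding.exists_forall_integral_Ioi_norm_le_of_isBigO_exp hα hφ
      norm_charFun_le_one hO
    refine (Decompounding.isBigO_integral_fHat_sub_density hlam hf_meas hf_nonneg hF hmean hφ hx
      h_pos hh hM hMO (a := α - 1 + 1) (c := Real.exp 1) hK fun T hT => ?_).congr_right fun n => ?_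
    · rw [← neg_sub α 1]
      exact Decompounding.exp_neg_mul_sq_le_rpow_neg_mul_exp hT (by linarith) (by linarith) hα2
    · rw [Decompounding.one_div_rpow_one_sub (h_pos n).le, Real.div_rpow zero_le_one (h_pos n).le,
        Real.one_rpow]
  · obtain ⟨K, hK⟩ := Decompounding.exists_forall_integral_Ioi_norm_le_of_isBigO_rpow hγ hφ
      norm_charFun_le_one hO
    refine (Decompounding.isBigO_integral_fHat_sub_density hlam hf_meas hf_nonneg hF hmean hφ hx
      h_pos hh hM hMO (a := γ - 1) (c := 1) hK fun T hT => ?_).congr_right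
        fun n => Decompounding.one_div_rpow_one_sub (h_pos n).le γ
    rw [one_mul, ← neg_sub γ 1]
    exact Decompounding.exp_neg_mul_sq_le_rpow_neg hT (by linarith)

theorem mainTheorem3 {Ω : Type*} [MeasurableSpace Ω] (P : Measure Ω) [IsProbabilityMeasure P]
    -- the known intensity
    (lam : ℝ≥0) (hlam : 0 < lam)
    -- the jump size distribution `F` with density `f`
    (F : Measure ℝ) [IsProbabilityMeasure F] (f : ℝ → ℝ) (hf_meas : Measurable f)
    (hf_nonneg : ∀ y, 0 ≤ f y) (hF : F = volume.withDensity fun y => ENNReal.ofReal (f y))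
    -- the i.i.d. observations `X_i = Y_i + Z_i`
    (X Y Z : ℕ → Ω → ℝ)
    (hY : ∀ i, HasLaw (Y i) (Decompounding.compoundPoisson lam F) P)
    (hZ : ∀ i, HasLaw (Z i) (gaussianReal 0 1) P)
    (hYZ : ∀ i, IndepFun (Y i) (Z i) P)
    (hXYZ : ∀ i ω, X i ω = Y i ω + Z i ω)
    (hX : iIndepFun X P)
    -- the characteristic function of `f` is integrable
    (hφ : Integrable (charFun F))
    -- the bandwidth
    (h : ℕ → ℝ) (h_pos : ∀ n, 0 < h n) (β : ℝ) (hβ : β < 1 / 2)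
    (hh : h ~[atTop] fun n : ℕ => Real.log n ^ (-β))
    -- the truncating sequence
    (M : ℕ → ℝ) (C : ℝ) (hC : 0 < C) (hM : ∀ n : ℕ, M n = C * Real.log n)
    -- the moment condition
    (ρ : ℝ) (hρ : 1 < ρ) (hmom : Integrable fun y : ℝ => |y| ^ ρ * f y)
    -- the point of estimation, where `f` agrees with its continuous version
    (x : ℝ) (hx : ContinuousAt f x) :
    (∀ n, Integrable (fun ω => Decompounding.fHat lam (h n) (M n) (fun j : Fin n => X j ω) x) P) ∧
    (∀ α : ℝ, 1 < α → α ≤ 2 →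
      charFun F =O[cocompact ℝ] (fun t : ℝ => Real.exp (-|t| ^ α)) →
      (fun n : ℕ =>
          (∫ ω, Decompounding.fHat lam (h n) (M n) (fun j : Fin n => X j ω) x ∂P) - f x)
        =O[atTop] fun n : ℕ => h n ^ (α - 1) * Real.exp (-(1 / h n ^ α))) ∧
    (∀ γ : ℝ, 1 < γ →
      charFun F =O[cocompact ℝ] (fun t : ℝ => |t| ^ (-γ)) →
      (fun n : ℕ =>
          (∫ ω, Decompounding.fHat lam (h n) (M n) (fun j : Fin n => X j ω) x ∂P) - f x)
        =O[atTop] fun n : ℕ => h n ^ (γ - 1)) := by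
  obtain ⟨hint, hexp, hpow⟩ := mainTheorem3_general P lam hlam F f hf_meas hf_nonneg hF
    (Decompounding.integrable_id_of_integrable_abs_rpow_mul hf_meas hf_nonneg hF hρ.le hmom) X
    (fun i => funext (hXYZ i) ▸ (hYZ i).hasLaw_fun_add (hY i) (hZ i)) hX hφ h h_pos
    (Decompounding.isLittleO_one_div_of_isEquivalent_log_rpow hβ hh) M
    (funext hM ▸ Decompounding.tendsto_log_natCast_atTop.const_mul_atTop hC)
    (funext hM ▸ isBigO_const_mul_self C _ _) x hx
  exact ⟨hint, fun α hα hα2 hO => hexp α hα.le hα2 (hO.mono atTop_le_cocompact),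
    fun γ hγ hO => hpow γ hγ (hO.mono atTop_le_cocompact)⟩
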